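/- **Setting.** Let $r,q\ge 1$. For a finite set $M$ let $s(M,r)$ be the set of its non-empty subsets of cardinality at most $r$, and $[n]=\{1,\dots,n\}$. For a compact space $\mathcal K$ with its Borel $\sigma$-algebra, a $(\mathcal K,r)$-graphon is a measurable function $W:[0,1]^{s([r],r)}\to\mathcal K$. For a finite set $E$, let $W=(W^e)_{e\in E}$ be a tuple of $(\mathcal K,r)$-graphons and $J=(J^e)_{e\in E}$ with $J^e=(J^e_z)_{z\in[q]^r}$, $J^e_z\in C(\mathcal K)$; put $\|J\|_\infty=\max_{e,z}\sup_{\mathcal K}|J^e_z|$. The ground state energy is $$\mathcal E(W,J)=\sup_{\phi}\ \sum_{e\in E}\ \sum_{z\in[q]^r}\int_{[0,1]^{s([r],r)}}J^e_z(W^e(x))\prod_{j=1}^r\phi_{z_j}(x_{\{j\}})\,dx ,$$ over all $q$-fractional partitions $\phi$ of $[0,1]$: measurable $\phi_1,\dots,\phi_q:[0,1]\to[0,1]$ with $\sum_m\phi_m(x)=1$ for every $x$. For a tuple $G=(G^e)_{e\in E}$ of arrays $G^e:[k]^r\to\mathcal K$ the integer ground state energy is $$\hat{\mathcal E}(G,J)=\max_{\sigma:[k]\to[q]}\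 \frac1{k^r}\sum_{e\in E}\ \sum_{n\in[k]^r}J^e_{(\sigma(n_1),\dots,\sigma(n_r))}\bigl(G^e_{n_1,\dots,n_r}\bigr).$$ The random tuple $\mathbb G(k,W)$ is obtained from independent uniform $[0,1]$ variables $(U_T)_{T\in s([k],r)}$, the same for all layers: for distinct $n_1,\dots,n_r\in[k]$ its $(n_1,\dots,n_r)$ entry in layer $e$ is $W^e\bigl((U_{\{n_j:\,j\in S\}})_{S\in s([r],r)}\bigr)$. The entries at tuples with a repeated vertex may be arbitrary elements of $\mathcal K$, possibly depending on $e$ and on the sample. **Theorem 4.2.** For all $r,q\ge1$ there is a function $k_0:(0,\infty)\to\mathbb N$, depending only on $r$ and $q$, with $k_0(\varepsilon)=O(\varepsilon^{-4}\log(\varepsilon^{-1}))$ as $\varepsilon\to0^+$, such that for every $\varepsilon>0$, every integer $k\ge k_0(\varepsilon)$ and every finite set $E$ the following hold. 1. For every compact space $\mathcal K$, all $J=(J^e)_{e\in E}$ with entries in $C(\mathcal K)$ and all tuples $W=(W^e)_{e\in E}$ of $(\mathcal K,r)$-graphons, $$\mathbb P\Bigl(\bigl|\mathcal E(W,J)-\hat{\mathcal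 E}(\mathbb G(k,W),J)\bigr|>\varepsilon\,|E|\,\|J\|_\infty\Bigr)<\varepsilon .$$ 2. Let the colours be real and let the interaction arrays $J=(J^e)_{e\in E}$ consist of real numbers acting by multiplication, $J^e_z(a)=J^e_z\cdot a$, with $\|J\|_\infty=\max_{e,z}|J^e_z|$. For all tuples $W=(W^e)_{e\in E}$ of measurable functions $W^e:[0,1]^{s([r],r)}\to\mathbb R$ and every real $M$ with $|W^e|\le M$ almost everywhere for all $e$ (for example $M=\|W\|_\infty$), if the entries at tuples with a repeated vertex have absolute value at most $M$, then $$\mathbb P\Bigl(\bigl|\mathcal E(W,J)-\hat{\mathcal E}(\mathbb G(k,W),J)\bigr|>\varepsilon\,|E|\,\|J\|_\infty\,M\Bigr)<\varepsilon .$$ (Probabilities of possibly non-measurable events are outer probabilities.) -/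

import Mathlib

open Filter Topology Asymptotics MeasureTheory

universe u v

noncomputable section

namespace GSE

/-- The set `s([n], r)` of non-empty subsets of `[n]` of cardinality at most `r`. -/
abbrev Subsets (n r : ℕ) : Type :=
  {S : Finset (Fin n) // S.Nonempty ∧ S.card ≤ r}

/-- The cube `[0,1]^{s([n], r)}`; its `volume` is the product of Lebesgue measures, i.e. the law of
independent uniform random variables `U_S`, `S ∈ s([n], r)`.  A `(K, r)`-graphon is a measurable
function `Cube r r → K`. -/
abbrev Cube (n r : ℕ) : Type := Subsets n r → unitInterval

/-- The singleton `{j}` as an element of `s([r], r)`. -/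
def single {r : ℕ} (j : Fin r) : Subsets r r :=
  ⟨{j}, Finset.singleton_nonempty j, by
    rw [Finset.card_singleton]; exact Nat.one_le_of_lt j.isLt⟩

/-- The set `{n_j : j ∈ S}` of vertices of the edge `(n_1, …, n_r)` at the positions in `S`. -/
def imageSubset {r k : ℕ} (n : Fin r → Fin k) (S : Subsets r r) : Subsets k r :=
  ⟨S.1.image n, S.2.1.image n, Finset.card_image_le.trans S.2.2⟩

/-- The random `K`-coloured directed `r`-graph on `[k]` obtained from the `(K, r)`-graphon `W` and
the sample `U`: the colour of an edge `(n_1, …, n_r)` with distinct vertices is `W` evaluated at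
the point whose `S`-coordinate is `U_{ {n_j : j ∈ S} }`.  The colours of the diagonal edges (those
with a repeated vertex) are prescribed by `diag`. -/
def sampledGraph {r k : ℕ} {K : Type*} (W : Cube r r → K) (diag : (Fin r → Fin k) → K)
    (U : Cube k r) (n : Fin r → Fin k) : K :=
  open Classical in
  if Function.Injective n then W (fun S => U (imageSubset n S)) else diag n

/-- `q`-fractional partitions of `[0,1]`. -/
def IsFractionalPartition {q : ℕ} (φ : Fin q → unitInterval → ℝ) : Prop :=
  (∀ m, Measurable (φ m)) ∧ (∀ m x, φ m x ∈ Set.Icc (0 : ℝ) 1) ∧ ∀ x, ∑ m, φ m x = 1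

/-- The energy `ℰ_φ(W, J)` of a graphon with respect to a fractional partition. -/
def energyAt {r q : ℕ} {K : Type*} (φ : Fin q → unitInterval → ℝ) (W : Cube r r → K)
    (J : (Fin r → Fin q) → K → ℝ) : ℝ :=
  ∑ z : Fin r → Fin q, ∫ x : Cube r r, J z (W x) * ∏ j, φ (z j) (x (single j))

/-- The layered ground state energy `ℰ(W, J)`: the largest value of `∑_{e ∈ E} ℰ_φ(W^e, J^e)` over
all `q`-fractional partitions `φ` of `[0,1]`. -/
def energy {r q : ℕ} {E K : Type*} [Fintype E] (W : E → Cube r r → K)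
    (J : E → (Fin r → Fin q) → K → ℝ) : ℝ :=
  sSup {v : ℝ | ∃ φ : Fin q → unitInterval → ℝ,
    IsFractionalPartition φ ∧ v = ∑ e, energyAt φ (W e) (J e)}

/-- The energy `ℰ_x(G, J)` of a `K`-coloured `r`-graph on `[k]` with respect to
`x = (x_{n,m})`. -/
def graphEnergyAt {r q k : ℕ} {K : Type*} (x : Fin k → Fin q → ℝ) (G : (Fin r → Fin k) → K)
    (J : (Fin r → Fin q) → K → ℝ) : ℝ :=
  1 / (k : ℝ) ^ r *
    ∑ z : Fin r → Fin q, ∑ n : Fin r → Fin k, J z (G n) * ∏ j, x (n j) (z j)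

/-- The layered integer ground state energy `ℰ̂(G, J)`: the maximum of `∑_{e ∈ E} ℰ_x(G^e, J^e)`
over all `q`-integer partitions `x` of `[k]`, i.e. `x_{n,m} = 1` if `σ n = m` and `0` otherwise
for a map `σ : [k] → [q]`. -/
def intEnergy {r q k : ℕ} {E K : Type*} [Fintype E] (G : E → (Fin r → Fin k) → K)
    (J : E → (Fin r → Fin q) → K → ℝ) : ℝ :=
  ⨆ σ : Fin k → Fin q, ∑ e, graphEnergyAt (fun n m => if σ n = m then 1 else 0) (G e) (J e)

end GSE

end

/-! Summing over the layers leaves a single bounded family `F z` of functions on the cube,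
normalized to |F| ≤ 1. Entries at repeated vertices affect the energy by O(1/k), so the bad event is
stated with an existential quantifier over all bounded arrays having the right off-diagonal entries.
This covers diagonals that depend on the sample.

Lower bound for the sampled energy: fix a near-optimal φ before sampling. The sampled average of
`mix F φ` concentrates (`measure_average_lt_le`), and rounding every vertex independently according
to φ has the same expected energy, so some map σ does at least as well (`exists_le_sum_comp`).

Upper bound: all q^k maps σ must be controlled at once, while the fluctuations of the vertex
variables only allow probabilities exp(-cε²k), too large for a union bound over σ. Two devices
resolve this. A variable belonging to a set of at least two vertices influences only O(k⁻²) of the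
edges, so McDiarmid's inequality gives exp(-cε²k²), which does beat q^k; averaging these variables
out leaves a kernel on the vertices (`measure_exists_vertexKernel_add_le`). For that kernel,
multiplicative weights show that every σ has, up to O(ε), at most the energy of a softmax of t =
O(ε⁻²) tests, each a section of the kernel with all but one argument frozen at sampled vertices
(`exists_softmax_fooling`, `multiform_le_add`). Such a softmax makes sense on all of [0,1], so it is
a fractional partition and its continuum energy is at most ℰ. There are only k^{O(t)} of them and
each depends on at most tr sampled vertices, so McDiarmid in the other vertices and a union bound
compare sampled and continuum energies (`measure_exists_samplePartition_le`).

The last union bound needs ε²k ≫ t log k with t ~ ε⁻², whence the rate ε⁻⁴ log(1/ε). -/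

namespace GSE

open ProbabilityTheory

/-! ### McDiarmid's inequality on product spaces, with some coordinates held fixed. -/

section Product

variable {Ω : Type*} [MeasureSpace Ω] [IsProbabilityMeasure (volume : Measure Ω)]
variable {ι κ κ' : Type*} [Fintype ι] [Fintype κ] [Fintype κ']

theorem integral_comp_measurePreserving {α β : Type*} [MeasurableSpace α] [MeasurableSpace β]
    {μ : Measure α} {ν : Measure β} {T : α → β} (hT : MeasurePreserving T μ ν) {f : β → ℝ}
    (hf : Measurable f) : ∫ x, f (T x) ∂μ = ∫ y, f y ∂ν := by
  rw [← hT.map_eq, integral_map hT.aemeasurable hf.aestronglyMeasurable]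

theorem integrable_of_measurable_of_abs_le {α : Type*} [MeasurableSpace α] {μ : Measure α}
    [IsFiniteMeasure μ] {f : α → ℝ} (hf : Measurable f) {C : ℝ} (hC : ∀ x, |f x| ≤ C) :
    Integrable f μ :=
  Integrable.of_bound hf.aestronglyMeasurable C (ae_of_all _ hC)

theorem abs_integral_le_of_abs_le {α : Type*} [MeasurableSpace α] {μ : Measure α}
    [IsProbabilityMeasure μ] {f : α → ℝ} {C : ℝ} (hC : ∀ x, |f x| ≤ C) : |∫ x, f x ∂μ| ≤ C := by
  simpa using norm_integral_le_of_norm_le_const (μ := μ) (f := f) (ae_of_all _ hC)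

/-- Reindexing along an injection preserves product probability measures. -/
theorem measurePreserving_comp_injective {g : κ → ι} (hg : Function.Injective g) :
    MeasurePreserving (fun x : ι → Ω => fun i => x (g i)) volume volume := by
  classical
  have hm : Measurable (fun x : ι → Ω => fun i => x (g i)) :=
    measurable_pi_lambda _ fun i => measurable_pi_apply (g i)
  refine ⟨hm, ?_⟩
  symm
  rw [volume_pi]
  refine Measure.pi_eq fun s hs => ?_
  rw [Measure.map_apply hm (MeasurableSet.univ_pi hs)]
  -- The preimage of a box is a box whose factors off the range of `g` are the whole space and so
  -- contribute 1.
  have : (fun x : ι → Ω => fun i => x (g i)) ⁻¹' (Set.univ.pi s) =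
      Set.univ.pi fun j => if h : ∃ i, g i = j then s h.choose else Set.univ := by
    ext x
    simp only [Set.mem_preimage, Set.mem_univ_pi]
    constructor
    · intro h j
      split_ifs with hj
      · have := h hj.choose
        rwa [hj.choose_spec] at this
      · trivial
    · intro h i
      have hi : ∃ i', g i' = g i := ⟨i, rfl⟩
      have := h (g i)
      rw [dif_pos hi, hg hi.choose_spec] at this
      exact this
  rw [this, volume_pi, Measure.pi_pi]
  symm
  refine Finset.prod_of_injOn g hg.injOn (fun _ _ => Finset.mem_univ _) ?_ ?_
  · intro j _ hj
    rw [dif_neg]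
    · simp
    · rintro ⟨i, rfl⟩
      exact hj ⟨i, by simp⟩
  · intro i _
    have hi : ∃ i', g i' = g i := ⟨i, rfl⟩
    rw [dif_pos hi, hg hi.choose_spec]

/-- Selecting coordinates injectively from two independent points. -/
theorem measurePreserving_sumElim {g : ι → κ ⊕ κ'} (hg : Function.Injective g) :
    MeasurePreserving (fun p : (κ → Ω) × (κ' → Ω) => fun i => Sum.elim p.1 p.2 (g i))
      volume volume := by
  have h1 := measurePreserving_sumPiEquivProdPi_symm (X := fun _ : κ ⊕ κ' => Ω)
    (fun _ => volume)
  have h2 := (measurePreserving_comp_injective (Ω := Ω) hg).comp h1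
  refine ⟨?_, ?_⟩
  · refine measurable_pi_lambda _ fun i => ?_
    rcases g i with a | a
    · exact (measurable_pi_apply a).comp measurable_fst
    · exact (measurable_pi_apply a).comp measurable_snd
  · rw [← h2.map_eq]
    congr 1

variable [DecidableEq ι]

/-- Resampling one coordinate preserves the product law; this is the form of Fubini that lets
coordinates be averaged out one at a time. -/
theorem measurePreserving_update (a : ι) :
    MeasurePreserving (fun p : (ι → Ω) × Ω => Function.update p.1 a p.2) volume volume := by
  have hg : Function.Injective
      (fun i => if i = a then Sum.inr () else Sum.inl i : ι → ι ⊕ Unit) := by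
    intro i j h
    by_cases hi : i = a <;> by_cases hj : j = a <;> simp_all
  have h1 := measurePreserving_sumElim (Ω := Ω) hg
  have h2 : MeasurePreserving (fun w : Ω => fun _ : Unit => w) volume volume := by
    refine ⟨by fun_prop, ?_⟩
    symm
    rw [volume_pi]
    refine Measure.pi_eq fun s hs => ?_
    rw [Measure.map_apply (by fun_prop) (MeasurableSet.univ_pi hs)]
    simp only [Finset.univ_unique, Finset.prod_singleton]
    congr 1
    ext w
    exact ⟨fun h => h () trivial, fun h _ _ => h⟩
  have h3 := h1.comp ((MeasurePreserving.id (volume : Measure (ι → Ω))).prod h2)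
  have : (fun p : (ι → Ω) × Ω => Function.update p.1 a p.2) =
      (fun p : (ι → Ω) × (Unit → Ω) => fun i =>
        Sum.elim p.1 p.2 (if i = a then Sum.inr () else Sum.inl i)) ∘
        Prod.map id fun w _ => w := by
    funext p i
    by_cases hi : i = a
    · subst hi
      simp
    · simp [hi]
  rw [this]
  exact h3

/-- The average of `f` over the coordinates in `I`. -/
noncomputable def avgOver (I : Finset ι) (f : (ι → Ω) → ℝ) (x : ι → Ω) : ℝ :=
  ∫ y : ι → Ω, f (I.piecewise y x)

theorem avgOver_empty (f : (ι → Ω) → ℝ) : avgOver ∅ f = f := by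
  funext x
  simp [avgOver]

theorem avgOver_univ (f : (ι → Ω) → ℝ) (x : ι → Ω) :
    avgOver Finset.univ f x = ∫ y, f y := by
  simp [avgOver]

theorem measurable_piecewise_prod (I : Finset ι) :
    Measurable (fun p : (ι → Ω) × (ι → Ω) => I.piecewise p.2 p.1) := by
  refine measurable_pi_lambda _ fun i => ?_
  by_cases hi : i ∈ I
  · simp only [hi, Finset.piecewise_eq_of_mem]
    fun_prop
  · simp only [hi, not_false_eq_true, Finset.piecewise_eq_of_notMem]
    fun_prop

theorem measurable_avgOver (I : Finset ι) {f : (ι → Ω) → ℝ} (hf : Measurable f) :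
    Measurable (avgOver I f) :=
  ((hf.comp (measurable_piecewise_prod I)).stronglyMeasurable.integral_prod_right'
    (ν := (volume : Measure (ι → Ω)))).measurable

theorem abs_avgOver_le (I : Finset ι) {f : (ι → Ω) → ℝ} {C : ℝ} (hC : ∀ x, |f x| ≤ C)
    (x : ι → Ω) : |avgOver I f x| ≤ C :=
  abs_integral_le_of_abs_le fun _ => hC _

theorem integral_update (a : ι) {f : (ι → Ω) → ℝ} (hf : Measurable f) {C : ℝ}
    (hC : ∀ x, |f x| ≤ C) :
    ∫ x, f x = ∫ x : ι → Ω, ∫ w : Ω, f (Function.update x a w) := by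
  rw [← integral_comp_measurePreserving (measurePreserving_update a) hf, Measure.volume_eq_prod,
    integral_prod]
  exact integrable_of_measurable_of_abs_le
    (hf.comp (measurePreserving_update (Ω := Ω) a).measurable) fun _ => hC _

theorem avgOver_insert {a : ι} {I : Finset ι} (ha : a ∉ I) {f : (ι → Ω) → ℝ}
    (hf : Measurable f) {C : ℝ} (hC : ∀ x, |f x| ≤ C) (x : ι → Ω) :
    avgOver (insert a I) f x = avgOver I (fun x => ∫ w, f (Function.update x a w)) x := by
  unfold avgOver
  have hm : Measurable fun y : ι → Ω => f ((insert a I).piecewise y x) :=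
    hf.comp ((measurable_piecewise_prod (insert a I)).comp (measurable_const.prodMk measurable_id))
  rw [integral_update a hm fun _ => hC _]
  refine integral_congr_ae (ae_of_all _ fun y => integral_congr_ae (ae_of_all _ fun w => ?_))
  simp only
  congr 1
  rw [Finset.piecewise_insert, Function.update_self]
  congr 1
  refine Finset.piecewise_congr _ (fun i hi => ?_) fun _ _ => rfl
  exact Function.update_of_ne (ne_of_mem_of_not_mem hi ha) _ _

theorem avgOver_update_of_notMem {a : ι} {I : Finset ι} (ha : a ∉ I) {f : (ι → Ω) → ℝ}
    (hf : ∀ x w, f (Function.update x a w) = f x) (x : ι → Ω) (w : Ω) :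
    avgOver I f (Function.update x a w) = avgOver I f x := by
  unfold avgOver
  refine integral_congr_ae (ae_of_all _ fun y => ?_)
  simp only
  rw [← Finset.update_piecewise_of_notMem _ _ _ ha, hf]

/-- Hoeffding's lemma for a function of oscillation at most `c`. -/
theorem integral_exp_sub_integral_le {f : Ω → ℝ} (hf : Measurable f) {c : ℝ}
    (hc : ∀ x y, |f x - f y| ≤ c) :
    ∫ w, Real.exp (f w - ∫ w', f w') ≤ Real.exp (c ^ 2 / 2) := by
  obtain ⟨w₀⟩ : Nonempty Ω := (volume : Measure Ω).nonempty_of_neZero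
  have hb : ∀ w, f w ∈ Set.Icc (f w₀ - c) (f w₀ + c) := fun w => by
    have := abs_le.1 (hc w w₀)
    constructor <;> linarith
  have h := (hasSubgaussianMGF_of_mem_Icc (μ := (volume : Measure Ω)) hf.aemeasurable
    (ae_of_all _ hb)).mgf_le 1
  simp only [mgf, one_mul] at h
  refine h.trans (Real.exp_le_exp.2 (le_of_eq ?_))
  have : f w₀ + c - (f w₀ - c) = 2 * c := by ring
  rw [this]
  have h0 : 0 ≤ c := (abs_nonneg _).trans (hc w₀ w₀)
  push_cast
  rw [Real.norm_of_nonneg (by linarith)]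
  ring

/-- The moment generating function bound of McDiarmid's inequality, with only the coordinates
in `I` averaged out. -/
theorem integral_exp_sub_avgOver_le (c : ι → ℝ) (I : Finset ι) :
    ∀ {f : (ι → Ω) → ℝ}, Measurable f → ∀ {C : ℝ}, (∀ x, |f x| ≤ C) →
      (∀ i ∈ I, ∀ x w, |f (Function.update x i w) - f x| ≤ c i) →
      ∫ x, Real.exp (f x - avgOver I f x) ≤ Real.exp (∑ i ∈ I, c i ^ 2 / 2) := by
  induction I using Finset.induction_on with
  | empty =>
    intro f _ C _ _
    simp [avgOver_empty]
  | insert a I ha ih =>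
    intro f hf C hC hc
    -- Martingale splitting: f minus its average is (f - g) + (g - average of g over I). The second
    -- term does not see coordinate `a`, so integrating that coordinate first leaves Hoeffding's
    -- lemma for f - g and the induction hypothesis for g.
    set g : (ι → Ω) → ℝ := fun x => ∫ w, f (Function.update x a w) with hg
    have hupd : Measurable fun p : (ι → Ω) × Ω => f (Function.update p.1 a p.2) :=
      hf.comp (measurePreserving_update (Ω := Ω) a).measurable
    have hgm : Measurable g :=
      (hupd.stronglyMeasurable.integral_prod_right' (ν := (volume : Measure Ω))).measurable
    have hgC : ∀ x, |g x| ≤ C := fun x => abs_integral_le_of_abs_le fun _ => hC _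
    have hfx : ∀ x, Measurable fun w => f (Function.update x a w) := fun x =>
      hupd.comp (measurable_const.prodMk measurable_id)
    have hgc : ∀ i ∈ I, ∀ x w, |g (Function.update x i w) - g x| ≤ c i := by
      intro i hi x w
      have hne : i ≠ a := fun h => ha (h ▸ hi)
      rw [hg]
      simp only
      rw [← integral_sub (integrable_of_measurable_of_abs_le (hfx _) fun _ => hC _)
        (integrable_of_measurable_of_abs_le (hfx _) fun _ => hC _)]
      refine abs_integral_le_of_abs_le fun v => ?_
      rw [Function.update_comm hne]
      exact hc i (Finset.mem_insert_of_mem hi) _ _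
    have hga : ∀ x w, g (Function.update x a w) = g x := fun x w => by simp [hg]
    have hA : ∀ x, avgOver (insert a I) f x = avgOver I g x := avgOver_insert ha hf hC
    have hAm := measurable_avgOver I hgm
    have hAC := abs_avgOver_le I hgC
    simp only [hA]
    have hbd : ∀ {u v : ℝ}, |u| ≤ C → |v| ≤ C → |Real.exp (u - v)| ≤ Real.exp (2 * C) := by
      intro u v hu hv
      rw [abs_of_pos (Real.exp_pos _)]
      exact Real.exp_le_exp.2 (by linarith [(abs_le.1 hu).2, (abs_le.1 hv).1])
    rw [integral_update a (f := fun x => Real.exp (f x - avgOver I g x))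
      (Real.measurable_exp.comp (hf.sub hAm)) fun x => hbd (hC x) (hAC x),
      Finset.sum_insert ha, Real.exp_add]
    calc ∫ x, ∫ w, Real.exp (f (Function.update x a w) - avgOver I g (Function.update x a w))
        ≤ ∫ x, Real.exp (c a ^ 2 / 2) * Real.exp (g x - avgOver I g x) := by
          refine integral_mono_of_nonneg (ae_of_all _ fun x => integral_nonneg fun w =>
            (Real.exp_pos _).le) ?_ (ae_of_all _ fun x => ?_)
          · exact (integrable_of_measurable_of_abs_le (Real.measurable_exp.comp (hgm.sub hAm))
              fun x => hbd (hgC x) (hAC x)).const_mul _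
          · have hsplit : ∀ w, Real.exp (f (Function.update x a w) -
                avgOver I g (Function.update x a w)) =
                Real.exp (f (Function.update x a w) - g x) *
                  Real.exp (g x - avgOver I g x) := by
              intro w
              rw [avgOver_update_of_notMem ha hga, ← Real.exp_add]
              congr 1
              ring
            simp only [hsplit]
            rw [integral_mul_const]
            refine mul_le_mul_of_nonneg_right ?_ (Real.exp_pos _).le
            refine integral_exp_sub_integral_le (hfx x) fun v w => ?_
            have := hc a (Finset.mem_insert_self a I) (Function.update x a w) v
            simpa using this
      _ = Real.exp (c a ^ 2 / 2) * ∫ x, Real.exp (g x - avgOver I g x) := integral_const_mul _ _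
      _ ≤ _ := mul_le_mul_of_nonneg_left (ih hgm hgC hgc) (Real.exp_pos _).le

/-- McDiarmid's inequality, with only the coordinates in `I` averaged out. -/
theorem measure_avgOver_add_le_le {c : ι → ℝ} {I : Finset ι} {f : (ι → Ω) → ℝ}
    (hf : Measurable f) {C : ℝ} (hC : ∀ x, |f x| ≤ C)
    (hc : ∀ i ∈ I, ∀ x w, |f (Function.update x i w) - f x| ≤ c i) {V : ℝ} (hV : 0 < V)
    (hcV : ∑ i ∈ I, c i ^ 2 ≤ V) {s : ℝ} (hs : 0 ≤ s) :
    (volume : Measure (ι → Ω)).real {x | avgOver I f x + s ≤ f x} ≤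
      Real.exp (-(s ^ 2 / (2 * V))) := by
  -- The minimizer of the Chernoff exponent -ls + l²V/2.
  set l : ℝ := s / V
  have hl : 0 ≤ l := div_nonneg hs hV.le
  have hAm := measurable_avgOver I hf
  have hAC := abs_avgOver_le I hC
  have hint : Integrable (fun x => Real.exp (l * (f x - avgOver I f x))) volume := by
    refine integrable_of_measurable_of_abs_le (C := Real.exp (l * (2 * C)))
      (by fun_prop) fun x => ?_
    rw [abs_of_pos (Real.exp_pos _)]
    refine Real.exp_le_exp.2 (mul_le_mul_of_nonneg_left ?_ hl)
    linarith [(abs_le.1 (hC x)).2, (abs_le.1 (hAC x)).1]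
  have h1 := measure_ge_le_exp_mul_mgf (μ := (volume : Measure (ι → Ω)))
    (X := fun x => f x - avgOver I f x) s hl hint
  have h2 : mgf (fun x => f x - avgOver I f x) volume l ≤ Real.exp (l ^ 2 * V / 2) := by
    have h3 := integral_exp_sub_avgOver_le (fun i => l * c i) I (f := fun x => l * f x)
      (hf.const_mul l) (C := l * C)
      (fun x => by rw [abs_mul, abs_of_nonneg hl]; exact mul_le_mul_of_nonneg_left (hC x) hl)
      (fun i hi x w => by
        rw [← mul_sub, abs_mul, abs_of_nonneg hl]
        exact mul_le_mul_of_nonneg_left (hc i hi x w) hl)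
    have h4 : ∀ x, avgOver I (fun x => l * f x) x = l * avgOver I f x := fun x =>
      integral_const_mul _ _
    simp only [h4, ← mul_sub] at h3
    refine h3.trans (Real.exp_le_exp.2 ?_)
    have : ∑ i ∈ I, (l * c i) ^ 2 / 2 = l ^ 2 / 2 * ∑ i ∈ I, c i ^ 2 := by
      rw [Finset.mul_sum]
      exact Finset.sum_congr rfl fun _ _ => by ring
    rw [this]
    nlinarith [mul_le_mul_of_nonneg_left hcV (by positivity : (0 : ℝ) ≤ l ^ 2 / 2)]
  have hset : {x | avgOver I f x + s ≤ f x} = {x | s ≤ f x - avgOver I f x} := by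
    ext x
    simp only [Set.mem_ofPred_eq]
    constructor <;> intro h <;> linarith
  rw [hset]
  refine h1.trans ((mul_le_mul_of_nonneg_left h2 (Real.exp_pos _).le).trans (le_of_eq ?_))
  rw [← Real.exp_add]
  congr 1
  simp only [l]
  field_simp
  ring

/-- Concentration of a normalized sum of bounded terms, each of which depends on at most `d` of
the averaged coordinates, when each coordinate affects a proportion at most `a` of the terms. -/
theorem measure_avgOver_sum_add_le_le {β : Type*} (N : Finset β) {g : β → (ι → Ω) → ℝ}
    (hg : ∀ n ∈ N, Measurable (g n)) (hg1 : ∀ n ∈ N, ∀ x, |g n x| ≤ 1) (D : β → Finset ι)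
    {I : Finset ι}
    (hD : ∀ n ∈ N, ∀ i ∈ I, i ∉ D n → ∀ x w, g n (Function.update x i w) = g n x)
    {w a d : ℝ} (hw : 0 ≤ w) (hwN : w * N.card ≤ 1) (ha : 0 < a) (hd : 0 < d)
    (hDa : ∀ i ∈ I, w * (N.filter fun n => i ∈ D n).card ≤ a)
    (hDd : ∀ n ∈ N, ((D n).card : ℝ) ≤ d) {s : ℝ} (hs : 0 ≤ s) :
    (volume : Measure (ι → Ω)).real
      {x | avgOver I (fun x => w * ∑ n ∈ N, g n x) x + s ≤ w * ∑ n ∈ N, g n x} ≤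
      Real.exp (-(s ^ 2 / (8 * a * d))) := by
  have hm : Measurable fun x => w * ∑ n ∈ N, g n x :=
    (Finset.measurable_fun_sum N hg).const_mul w
  have hb : ∀ x, |w * ∑ n ∈ N, g n x| ≤ 1 := fun x => by
    rw [abs_mul, abs_of_nonneg hw]
    refine le_trans (mul_le_mul_of_nonneg_left ?_ hw) hwN
    refine (Finset.abs_sum_le_sum_abs _ _).trans ?_
    simpa using Finset.sum_le_sum fun n hn => hg1 n hn x
  set m : ι → ℝ := fun i => w * (N.filter fun n => i ∈ D n).card with hmdef
  have hm0 : ∀ i, 0 ≤ m i := fun i => by positivity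
  have hc : ∀ i ∈ I, ∀ x v,
      |(w * ∑ n ∈ N, g n (Function.update x i v)) - w * ∑ n ∈ N, g n x| ≤ 2 * m i := by
    intro i hi x v
    rw [← mul_sub, ← Finset.sum_sub_distrib, abs_mul, abs_of_nonneg hw, hmdef]
    have : |∑ n ∈ N, (g n (Function.update x i v) - g n x)| ≤
        2 * (N.filter fun n => i ∈ D n).card := by
      refine (Finset.abs_sum_le_sum_abs _ _).trans ?_
      rw [← Finset.sum_filter_add_sum_filter_not N (fun n => i ∈ D n)]
      have h0 : ∑ n ∈ N with i ∉ D n, |g n (Function.update x i v) - g n x| = 0 := by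
        refine Finset.sum_eq_zero fun n hn => ?_
        rw [Finset.mem_filter] at hn
        rw [hD n hn.1 i hi hn.2, sub_self, abs_zero]
      rw [h0, add_zero, mul_comm, ← nsmul_eq_mul]
      refine Finset.sum_le_card_nsmul _ _ _ fun n hn => ?_
      have hn' := (Finset.mem_filter.1 hn).1
      have h1 := abs_le.1 (hg1 n hn' (Function.update x i v))
      have h2 := abs_le.1 (hg1 n hn' x)
      rw [abs_le]
      constructor <;> linarith
    calc _ ≤ w * (2 * ((N.filter fun n => i ∈ D n).card : ℝ)) :=
          mul_le_mul_of_nonneg_left this hw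
      _ = _ := by ring
  -- The sum of squares is at most the maximum times the sum: each influence `m i` is at most a, and
  -- double counting bounds their sum by d.
  have hsum : ∑ i ∈ I, (2 * m i) ^ 2 ≤ 4 * a * d := by
    have h1 : ∑ i ∈ I, m i ≤ d := by
      calc ∑ i ∈ I, m i ≤ ∑ i, m i :=
            Finset.sum_le_univ_sum_of_nonneg hm0
        _ = w * ∑ n ∈ N, ((D n).card : ℝ) := by
            simp only [hmdef]
            rw [← Finset.mul_sum]
            congr 1
            have := Finset.sum_card_bipartiteAbove_eq_sum_card_bipartiteBelow
              (s := (Finset.univ : Finset ι)) (t := N) (fun i n => i ∈ D n)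
            simp only [Finset.bipartiteAbove, Finset.bipartiteBelow] at this
            rw [← Nat.cast_sum, this, Nat.cast_sum]
            simp
        _ ≤ w * (N.card * d) := by
            refine mul_le_mul_of_nonneg_left ?_ hw
            rw [← nsmul_eq_mul]
            exact Finset.sum_le_card_nsmul _ _ _ hDd
        _ ≤ d := by nlinarith
    calc ∑ i ∈ I, (2 * m i) ^ 2 ≤ ∑ i ∈ I, 4 * a * m i := by
          refine Finset.sum_le_sum fun i hi => ?_
          nlinarith [mul_le_mul_of_nonneg_right (hDa i hi) (hm0 i)]
      _ = 4 * a * ∑ i ∈ I, m i := by rw [Finset.mul_sum]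
      _ ≤ _ := mul_le_mul_of_nonneg_left h1 (by positivity)
  have := measure_avgOver_add_le_le hm hb hc (by positivity) hsum hs
  convert this using 3
  ring

end Product


/-! ### Exponential weights: one-step estimate for the log-partition function. -/

section Softmax

variable {q : ℕ}

/-- The exponential weights associated with a vector of scores. -/
noncomputable def softmax (h : Fin q → ℝ) (m : Fin q) : ℝ := Real.exp (h m) / ∑ l, Real.exp (h l)

theorem sum_exp_pos [NeZero q] (h : Fin q → ℝ) : 0 < ∑ l, Real.exp (h l) :=
  Finset.sum_pos (fun _ _ => Real.exp_pos _) Finset.univ_nonempty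

theorem softmax_nonneg (h : Fin q → ℝ) (m : Fin q) : 0 ≤ softmax h m :=
  div_nonneg (Real.exp_pos _).le (Finset.sum_nonneg fun _ _ => (Real.exp_pos _).le)

theorem sum_softmax [NeZero q] (h : Fin q → ℝ) : ∑ m, softmax h m = 1 := by
  simp only [softmax]
  rw [← Finset.sum_div, div_self (sum_exp_pos h).ne']

/-- One step of exponential weights: change of the log-partition function. -/
theorem log_sum_exp_add_le [NeZero q] (h f : Fin q → ℝ) (hf : ∀ m, |f m| ≤ 1) {η : ℝ}
    (hη : 0 ≤ η) (hη1 : η ≤ 1) :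
    Real.log (∑ m, Real.exp (h m + η * f m)) ≤
      Real.log (∑ m, Real.exp (h m)) + η * ∑ m, f m * softmax h m + η ^ 2 := by
  set Z := ∑ m, Real.exp (h m) with hZ
  have hZ0 : 0 < Z := sum_exp_pos h
  have h1 : ∑ m, Real.exp (h m + η * f m) ≤
      Z * (1 + (η * ∑ m, f m * softmax h m + η ^ 2)) := by
    have hs : Z * (1 + (η * ∑ m, f m * softmax h m + η ^ 2)) =
        ∑ m, Real.exp (h m) * (1 + η * f m + η ^ 2) := by
      have : ∀ m, Real.exp (h m) * (1 + η * f m + η ^ 2) =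
          Real.exp (h m) * (1 + η ^ 2) + Z * (η * (f m * softmax h m)) := by
        intro m
        simp only [softmax, ← hZ]
        field_simp
        ring
      simp only [this]
      rw [Finset.sum_add_distrib, ← Finset.sum_mul, ← Finset.mul_sum, ← Finset.mul_sum, ← hZ]
      ring
    rw [hs]
    refine Finset.sum_le_sum fun m _ => ?_
    rw [Real.exp_add]
    refine mul_le_mul_of_nonneg_left ?_ (Real.exp_pos _).le
    have hx : |η * f m| ≤ 1 := by
      rw [abs_mul, abs_of_nonneg hη]
      nlinarith [hf m, abs_nonneg (f m)]
    -- The estimate exp x ≤ 1 + x + x² for |x| ≤ 1 is why η ≤ 1 is required.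
    have h2 := (abs_le.1 (Real.abs_exp_sub_one_sub_id_le hx)).2
    have h3 : (η * f m) ^ 2 ≤ η ^ 2 := by
      rw [mul_pow]
      have : f m ^ 2 ≤ 1 := by
        rw [← sq_abs]
        nlinarith [hf m, abs_nonneg (f m)]
      nlinarith [sq_nonneg η]
    linarith
  have hpos : 0 < ∑ m, Real.exp (h m + η * f m) := sum_exp_pos _
  have hpos' : 0 < 1 + (η * ∑ m, f m * softmax h m + η ^ 2) :=
    pos_of_mul_pos_right (hpos.trans_le h1) hZ0.le
  calc Real.log (∑ m, Real.exp (h m + η * f m))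
      ≤ Real.log (Z * (1 + (η * ∑ m, f m * softmax h m + η ^ 2))) := Real.log_le_log hpos h1
    _ = Real.log Z + Real.log (1 + (η * ∑ m, f m * softmax h m + η ^ 2)) :=
        Real.log_mul hZ0.ne' hpos'.ne'
    _ ≤ _ := by linarith [Real.log_le_sub_one_of_pos hpos']

theorem le_log_sum_exp (h : Fin q → ℝ) (m : Fin q) : h m ≤ Real.log (∑ l, Real.exp (h l)) := by
  rw [Real.le_log_iff_exp_le (Finset.sum_pos (fun _ _ => Real.exp_pos _) ⟨m, Finset.mem_univ m⟩)]
  exact Finset.single_le_sum (f := fun l => Real.exp (h l)) (fun _ _ => (Real.exp_pos _).le)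
    (Finset.mem_univ m)

end Softmax

/-! ### Boosting: approximating a map by a softmax of few tests. -/

section Fooling

variable {k q : ℕ} {T : Type*}

/-- The total score of a list of at most `t` tests. -/
def totalScore (η : ℝ) {α : Type*} (f : T → α → ℝ) {t : ℕ} (c : Fin t → Option T) (a : α) : ℝ :=
  η * ∑ i, (c i).elim 0 fun τ => f τ a

/-- Every map `σ : [k] → [q]` is indistinguishable, by a family of bounded tests, from the
exponential weights of few of these tests. -/
theorem exists_softmax_fooling [NeZero q] (hk : 0 < k) (f : T → Fin k → Fin q → ℝ)
    (hf : ∀ τ n m, |f τ n m| ≤ 1) (σ : Fin k → Fin q) {ε : ℝ} (hε : 0 < ε) (hε1 : ε ≤ 1) {t : ℕ}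
    (ht : 4 * Real.log q < t * ε ^ 2) :
    ∃ c : Fin t → Option T, ∀ τ, ∑ n, (f τ n (σ n) - ∑ m, f τ n m *
      softmax (fun m => totalScore (ε / 2) (fun τ (p : Fin k × Fin q) => f τ p.1 p.2) c (n, m)) m)
        ≤ k * ε := by
  obtain ⟨S, hS⟩ : ∃ S : ∀ s : ℕ, (Fin s → Option T) → Fin k → Fin q → ℝ, S = fun _ c n m =>
    totalScore (ε / 2) (fun τ (p : Fin k × Fin q) => f τ p.1 p.2) c (n, m) := ⟨_, rfl⟩
  -- The potential is the total relative entropy of the point masses at `σ n` with respect to the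
  -- softmax. It is nonnegative and equals k log q for zero scores.
  set Ψ : (Fin k → Fin q → ℝ) → ℝ := fun h =>
    ∑ n, (Real.log (∑ m, Real.exp (h n m)) - h n (σ n)) with hΨ
  have hΨ0 : ∀ h, 0 ≤ Ψ h := fun h => Finset.sum_nonneg fun n _ =>
    sub_nonneg.2 (le_log_sum_exp _ _)
  have key : ∀ s : ℕ, ∃ c : Fin s → Option T,
      (∀ τ, ∑ n, (f τ n (σ n) - ∑ m, f τ n m * softmax (S s c n) m) ≤ k * ε) ∨
        Ψ (S s c) ≤ k * (Real.log q - s * (ε ^ 2 / 4)) := by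
    intro s
    induction s with
    | zero =>
      refine ⟨Fin.elim0, Or.inr ?_⟩
      simp [hΨ, hS, totalScore]
    | succ s ih =>
      obtain ⟨c, hc⟩ := ih
      by_cases hgood : ∀ τ, ∑ n, (f τ n (σ n) - ∑ m, f τ n m * softmax (S s c n) m) ≤ k * ε
      -- Once all tests are fooled, the list is padded by `none`, which adds nothing to the score,
      -- so that its length is exactly t in the end.
      · refine ⟨Fin.snoc c none, Or.inl ?_⟩
        have : S (s + 1) (Fin.snoc c none : Fin (s + 1) → Option T) = S s c := by
          funext n m
          simp [hS, totalScore, Fin.sum_univ_castSucc]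
        rwa [this]
      · have hc' := hc.resolve_left hgood
        push Not at hgood
        obtain ⟨τ, hτ⟩ := hgood
        refine ⟨Fin.snoc c (some τ), Or.inr ?_⟩
        have hSs : ∀ n m, S (s + 1) (Fin.snoc c (some τ) : Fin (s + 1) → Option T) n m =
            S s c n m + ε / 2 * f τ n m := by
          intro n m
          simp [hS, totalScore, Fin.sum_univ_castSucc, mul_add]
        -- A violated test gains more than (ε/2)·kε from the linear term against a quadratic loss
        -- k(ε/2)², a net drop of at least kε²/4; the step η = ε/2 maximizes ηε - η².
        have hstep : Ψ (S (s + 1) (Fin.snoc c (some τ) : Fin (s + 1) → Option T)) ≤ Ψ (S s c) -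
            ε / 2 * ∑ n, (f τ n (σ n) - ∑ m, f τ n m * softmax (S s c n) m) +
              k * (ε / 2) ^ 2 := by
          have : (k : ℝ) * (ε / 2) ^ 2 = ∑ _n : Fin k, (ε / 2) ^ 2 := by simp
          rw [this, hΨ, Finset.mul_sum, ← Finset.sum_sub_distrib, ← Finset.sum_add_distrib]
          refine Finset.sum_le_sum fun n _ => ?_
          simp only [hSs]
          have := log_sum_exp_add_le (S s c n) (f τ n) (hf τ n) (η := ε / 2) (by linarith)
            (by linarith)
          linarith
        push_cast
        nlinarith [mul_lt_mul_of_pos_left hτ hε]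
  obtain ⟨c, hc⟩ := key t
  have hgood := hc.resolve_right fun h => ?_
  · refine ⟨c, ?_⟩
    simpa only [hS] using hgood
  have hk' : (0 : ℝ) < k := by exact_mod_cast hk
  have h1 := (hΨ0 (S t c)).trans h
  have h2 := nonneg_of_mul_nonneg_right h1 hk'
  linarith

end Fooling

/-! ### Multilinear energies: stability under fooling, and randomized rounding. -/

section Multilinear

variable {k q r : ℕ}

/-- Exchanging the new value with the old entry at `p` is an involution on pairs (map, value):
resampling an entry of a uniform map keeps it uniform. -/
theorem sum_update_eq {ι α : Type*} [Fintype ι] [DecidableEq ι] [Fintype α] (p : ι)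
    (Φ : (ι → α) → ℝ) :
    ∑ n : ι → α, ∑ v : α, Φ (Function.update n p v) = Fintype.card α * ∑ n, Φ n := by
  have hinv : Function.Involutive fun x : (ι → α) × α => (Function.update x.1 p x.2, x.1 p) := by
    intro x
    simp
  rw [← Fintype.sum_prod_type' (f := fun (n : ι → α) v => Φ (Function.update n p v)),
    ← Equiv.sum_comp hinv.toPerm]
  simp only [Function.Involutive.coe_toPerm, Function.update_idem, Function.update_eq_self]
  rw [Fintype.sum_prod_type]
  simp [Finset.mul_sum]

theorem sum_prod_eq_one {ι α : Type*} [Fintype ι] [DecidableEq ι] [Fintype α]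
    {x : ι → α → ℝ} (hx : ∀ j, ∑ m, x j m = 1) : ∑ z : ι → α, ∏ j, x j (z j) = 1 := by
  have := Finset.prod_univ_sum (fun _ : ι => (Finset.univ : Finset α)) x
  rw [Fintype.piFinset_univ] at this
  rw [← this]
  simp [hx]

theorem abs_sum_mul_prod_le {ι α : Type*} [Fintype ι] [DecidableEq ι] [Fintype α]
    {x : ι → α → ℝ} (hx0 : ∀ j m, 0 ≤ x j m) (hx : ∀ j, ∑ m, x j m = 1) {a : (ι → α) → ℝ}
    {C : ℝ} (ha : ∀ z, |a z| ≤ C) : |∑ z : ι → α, a z * ∏ j, x j (z j)| ≤ C := by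
  refine (Finset.abs_sum_le_sum_abs _ _).trans ?_
  calc ∑ z : ι → α, |a z * ∏ j, x j (z j)| ≤ ∑ z : ι → α, C * ∏ j, x j (z j) := by
        refine Finset.sum_le_sum fun z _ => ?_
        have h0 : 0 ≤ ∏ j, x j (z j) := Finset.prod_nonneg fun j _ => hx0 _ _
        rw [abs_mul, abs_of_nonneg h0]
        exact mul_le_mul_of_nonneg_right (ha z) h0
    _ = C := by rw [← Finset.mul_sum, sum_prod_eq_one hx, mul_one]

/-- The multilinear form of an array, with separate arguments for the different positions. -/
def multiform (A : (Fin r → Fin q) → (Fin r → Fin k) → ℝ) (c : Fin r → Fin k → Fin q → ℝ) : ℝ :=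
  ∑ n : Fin r → Fin k, ∑ z : Fin r → Fin q, A z n * ∏ j, c j (n j) (z j)

/-- The change of the multilinear form when one argument is replaced. -/
theorem multiform_sub_update_le (hk : 0 < k) [NeZero q]
    (A : (Fin r → Fin q) → (Fin r → Fin k) → ℝ)
    {c : Fin r → Fin k → Fin q → ℝ} (hc0 : ∀ j n m, 0 ≤ c j n m) (hc : ∀ j n, ∑ m, c j n m = 1)
    (p : Fin r) (b : Fin k → Fin q → ℝ) {ε : ℝ}
    (hb : ∀ z y, ∑ n, ∑ m, A (Function.update z p m) (Function.update y p n) *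
      (c p n m - b n m) ≤ k * ε) :
    multiform A c - multiform A (Function.update c p b) ≤ k ^ r * ε := by
  have hk' : (0 : ℝ) < k := by exact_mod_cast hk
  have hq' : (0 : ℝ) < q := by exact_mod_cast Nat.pos_of_ne_zero (NeZero.ne q)
  set w : (Fin r → Fin q) → (Fin r → Fin k) → ℝ := fun z n =>
    ∏ j ∈ Finset.univ.erase p, c j (n j) (z j) with hw
  have hw0 : ∀ z n, 0 ≤ w z n := fun z n => Finset.prod_nonneg fun j _ => hc0 _ _ _
  have hdiff : multiform A c - multiform A (Function.update c p b) =
      ∑ n, ∑ z, A z n * (c p (n p) (z p) - b (n p) (z p)) * w z n := by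
    simp only [multiform, ← Finset.sum_sub_distrib]
    refine Finset.sum_congr rfl fun n _ => Finset.sum_congr rfl fun z _ => ?_
    rw [← Finset.mul_prod_erase _ _ (Finset.mem_univ p),
      ← Finset.mul_prod_erase _ (fun j => Function.update c p b j (n j) (z j))
        (Finset.mem_univ p), Function.update_self]
    have : ∏ j ∈ Finset.univ.erase p, Function.update c p b j (n j) (z j) = w z n :=
      Finset.prod_congr rfl fun j hj => by rw [Function.update_of_ne (Finset.ne_of_mem_erase hj)]
    rw [this]
    ring
  have hwu : ∀ z n m v, w (Function.update z p m) (Function.update n p v) = w z n := by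
    intro z n m v
    refine Finset.prod_congr rfl fun j hj => ?_
    rw [Function.update_of_ne (Finset.ne_of_mem_erase hj),
      Function.update_of_ne (Finset.ne_of_mem_erase hj)]
  have hwsum : ∑ n : Fin r → Fin k, ∑ z, w z n = k ^ r * q := by
    have h1 : ∀ n : Fin r → Fin k, ∑ z, w z n = q := by
      intro n
      have h2 := sum_update_eq p fun z : Fin r → Fin q => ∏ j, c j (n j) (z j)
      rw [sum_prod_eq_one fun j => hc j _, Fintype.card_fin, mul_one] at h2
      rw [← h2]
      refine Finset.sum_congr rfl fun z _ => ?_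
      have : ∀ m, ∏ j, c j (n j) (Function.update z p m j) = c p (n p) m * w z n := by
        intro m
        rw [← Finset.mul_prod_erase _ _ (Finset.mem_univ p), Function.update_self]
        congr 1
        exact Finset.prod_congr rfl fun j hj => by
          rw [Function.update_of_ne (Finset.ne_of_mem_erase hj)]
      simp only [this]
      rw [← Finset.sum_mul, hc, one_mul]
    simp [h1]
  rw [hdiff]
  set Φ : (Fin r → Fin k) → (Fin r → Fin q) → ℝ := fun n z =>
    A z n * (c p (n p) (z p) - b (n p) (z p)) * w z n with hΦ
  -- The weight `w` ignores the p-th entries of `n` and `z`. Resampling these entries turns every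
  -- summand into one complete test times `w`, so that `hb` applies termwise.
  have havg : k * (q * ∑ n, ∑ z, Φ n z) = ∑ n, ∑ z, (∑ v, ∑ m,
      A (Function.update z p m) (Function.update n p v) * (c p v m - b v m)) * w z n := by
    have h1 := sum_update_eq p fun n => ∑ z, Φ n z
    rw [Fintype.card_fin] at h1
    rw [mul_left_comm, ← h1, Finset.mul_sum]
    refine Finset.sum_congr rfl fun n _ => ?_
    rw [Finset.mul_sum]
    have h2 : ∀ v, (q : ℝ) * ∑ z, Φ (Function.update n p v) z =
        ∑ z, ∑ m, Φ (Function.update n p v) (Function.update z p m) := by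
      intro v
      rw [sum_update_eq p fun z => Φ (Function.update n p v) z, Fintype.card_fin]
    simp only [h2]
    rw [Finset.sum_comm]
    refine Finset.sum_congr rfl fun z _ => ?_
    rw [Finset.sum_mul]
    refine Finset.sum_congr rfl fun v _ => ?_
    rw [Finset.sum_mul]
    refine Finset.sum_congr rfl fun m _ => ?_
    simp only [hΦ, hwu, Function.update_self]
  have hle : k * (q * ∑ n, ∑ z, Φ n z) ≤ k * (q * (k ^ r * ε)) := by
    rw [havg]
    calc _ ≤ ∑ n, ∑ z, (k * ε) * w z n :=
          Finset.sum_le_sum fun n _ => Finset.sum_le_sum fun z _ =>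
            mul_le_mul_of_nonneg_right (hb z n) (hw0 z n)
      _ = (k * ε) * ∑ n : Fin r → Fin k, ∑ z, w z n := by
          simp only [Finset.mul_sum]
      _ = _ := by rw [hwsum]; ring
  exact le_of_mul_le_mul_left (le_of_mul_le_mul_left hle hk') hq'

/-- Two arguments that agree on all tests have close values of the multilinear form. -/
theorem multiform_le_add (hk : 0 < k) [NeZero q]
    (A : (Fin r → Fin q) → (Fin r → Fin k) → ℝ)
    {a b : Fin k → Fin q → ℝ} (ha0 : ∀ n m, 0 ≤ a n m) (ha : ∀ n, ∑ m, a n m = 1)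
    (hb0 : ∀ n m, 0 ≤ b n m) (hb : ∀ n, ∑ m, b n m = 1) {ε : ℝ}
    (hab : ∀ p z y, ∑ n, ∑ m, A (Function.update z p m) (Function.update y p n) *
      (a n m - b n m) ≤ k * ε) :
    multiform A (fun _ => a) ≤ multiform A (fun _ => b) + k ^ r * (r * ε) := by
  -- Hybrid argument: `a` is exchanged for `b` one position at a time, each exchange costing k^r ε.
  have key : ∀ S : Finset (Fin r), multiform A (fun _ => a) ≤
      multiform A (fun j => if j ∈ S then b else a) + k ^ r * (S.card * ε) := by
    intro S
    induction S using Finset.induction_on with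
    | empty => simp
    | insert p S hp ih =>
      have h1 := multiform_sub_update_le hk A (c := fun j => if j ∈ S then b else a)
        (fun j n m => by split_ifs; exacts [hb0 n m, ha0 n m])
        (fun j n => by split_ifs; exacts [hb n, ha n]) p b (ε := ε)
        (fun z y => by simpa [hp] using hab p z y)
      have h2 : Function.update (fun j => if j ∈ S then b else a) p b =
          fun j => if j ∈ insert p S then b else a := by
        funext j
        by_cases hj : j = p
        · subst hj
          simp
        · simp [hj]
      rw [h2] at h1
      rw [Finset.card_insert_of_notMem hp]
      push_cast
      linarith
  simpa using key Finset.univ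

/-- The index set of the tests of a multilinear form. -/
abbrev Test (r q k : ℕ) : Type := (Fin r → Fin q) × Fin r × (Fin r → Fin k)

/-- A test (z, p, y) is the section of `A` in position p, the other arguments being frozen at z and
y. Fooling all sections up to ε costs rε in the energy, one ε for each position. -/
theorem exists_softmax_multiform_le (hk : 0 < k) [NeZero q]
    (A : (Fin r → Fin q) → (Fin r → Fin k) → ℝ) (hA : ∀ z n, |A z n| ≤ 1) (σ : Fin k → Fin q)
    {ε : ℝ} (hε : 0 < ε) (hε1 : ε ≤ 1) {t : ℕ} (ht : 4 * Real.log q < t * ε ^ 2) :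
    ∃ c : Fin t → Option (Test r q k),
      ∑ n, A (σ ∘ n) n ≤ multiform A (fun _ n => softmax fun m => totalScore (ε / 2)
        (fun τ (x : Fin k × Fin q) => A (Function.update τ.1 τ.2.1 x.2)
          (Function.update τ.2.2 τ.2.1 x.1)) c (n, m)) + k ^ r * (r * ε) := by
  obtain ⟨c, hc⟩ := exists_softmax_fooling hk
    (fun (τ : Test r q k) n m => A (Function.update τ.1 τ.2.1 m) (Function.update τ.2.2 τ.2.1 n))
    (fun _ _ _ => hA _ _) σ hε hε1 ht
  refine ⟨c, ?_⟩
  generalize hb : (fun n => softmax fun m => totalScore (ε / 2)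
        (fun (τ : Test r q k) (x : Fin k × Fin q) => A (Function.update τ.1 τ.2.1 x.2)
          (Function.update τ.2.2 τ.2.1 x.1)) c (n, m)) = b
  have hb' : ∀ n, (softmax fun m => totalScore (ε / 2)
        (fun (τ : Test r q k) (x : Fin k × Fin q) => A (Function.update τ.1 τ.2.1 x.2)
          (Function.update τ.2.2 τ.2.1 x.1)) c (n, m)) = b n := fun n => congrFun hb n
  simp only [hb'] at hc
  set a : Fin k → Fin q → ℝ := fun n m => if σ n = m then 1 else 0 with ha
  have h1 : ∑ n, A (σ ∘ n) n = multiform A fun _ => a := by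
    refine Finset.sum_congr rfl fun n _ => ?_
    rw [Finset.sum_eq_single (σ ∘ n)]
    · simp [ha]
    · intro z _ hz
      obtain ⟨j, hj⟩ := Function.ne_iff.1 hz
      rw [Finset.prod_eq_zero (Finset.mem_univ j), mul_zero]
      exact if_neg (Ne.symm hj)
    · simp
  rw [h1]
  have ha0 : ∀ n m, 0 ≤ a n m := fun n m => by
    simp only [ha]
    split_ifs <;> norm_num
  have ha1 : ∀ n, ∑ m, a n m = 1 := fun n => by simp [ha]
  have hb0 : ∀ n m, 0 ≤ b n m := fun n m => hb' n ▸ softmax_nonneg _ _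
  have hb1 : ∀ n, ∑ m, b n m = 1 := fun n => hb' n ▸ sum_softmax _
  refine multiform_le_add hk A ha0 ha1 hb0 hb1 fun p z y => ?_
  convert hc (z, p, y) using 2 with n
  simp only [ha, mul_sub, Finset.sum_sub_distrib, mul_ite, mul_one, mul_zero, Finset.sum_ite_eq,
    Finset.mem_univ, if_true]

/-- A fractional assignment can be rounded to a map without decreasing an injective form. -/
theorem exists_le_sum_comp (A : (Fin r → Fin q) → (Fin r → Fin k) → ℝ)
    {x : Fin k → Fin q → ℝ} (hx0 : ∀ n m, 0 ≤ x n m) (hx : ∀ n, ∑ m, x n m = 1)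
    {N : Finset (Fin r → Fin k)} (hN : ∀ n ∈ N, Function.Injective n) :
    ∃ σ : Fin k → Fin q,
      ∑ n ∈ N, ∑ z, A z n * ∏ j, x (n j) (z j) ≤ ∑ n ∈ N, A (σ ∘ n) n := by
  by_contra! hcon
  -- The law of a random map with independent values `σ i` of distribution `x i`. For injective `n`
  -- the values along `n` are independent, so the expected integer energy is the fractional one, and
  -- some σ reaches its mean.
  set w : (Fin k → Fin q) → ℝ := fun σ => ∏ i, x i (σ i) with hw
  have hw0 : ∀ σ, 0 ≤ w σ := fun σ => Finset.prod_nonneg fun i _ => hx0 _ _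
  have hw1 : ∑ σ, w σ = 1 := sum_prod_eq_one hx
  have hmarg : ∀ n ∈ N, ∀ z : Fin r → Fin q,
      ∑ σ, w σ * (if σ ∘ n = z then 1 else 0) = ∏ j, x (n j) (z j) := by
    intro n hn z
    have hinj := hN n hn
    have h1 : ∀ σ : Fin k → Fin q, w σ * (if σ ∘ n = z then 1 else 0) =
        ∏ i, (x i (σ i) * ∏ j, if n j = i then (if σ i = z j then (1 : ℝ) else 0) else 1) := by
      intro σ
      rw [Finset.prod_mul_distrib, Finset.prod_comm]
      congr 1
      simp only [Finset.prod_ite_eq, Finset.mem_univ, if_true]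
      rw [Fintype.prod_ite_zero]
      simp [funext_iff]
    simp only [h1]
    rw [← Fintype.piFinset_univ, ← Finset.prod_univ_sum (fun _ : Fin k => (Finset.univ))
      (fun i m => x i m * ∏ j, if n j = i then (if m = z j then (1 : ℝ) else 0) else 1)]
    symm
    refine Finset.prod_of_injOn n hinj.injOn (fun _ _ => Finset.mem_univ _) ?_ ?_
    · intro i _ hi
      have : ∀ j, n j ≠ i := fun j hj => hi ⟨j, by simp, hj⟩
      simp [this, hx]
    · intro j _
      have : ∀ m, (∏ j', if n j' = n j then (if m = z j' then (1 : ℝ) else 0) else 1) =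
          if m = z j then 1 else 0 := by
        intro m
        rw [Finset.prod_eq_single j]
        · simp
        · intro j' _ hj'
          rw [if_neg fun h => hj' (hinj h)]
        · simp
      simp [this]
  have h2 : ∑ σ, w σ * ∑ n ∈ N, A (σ ∘ n) n = ∑ n ∈ N, ∑ z, A z n * ∏ j, x (n j) (z j) := by
    simp only [Finset.mul_sum]
    rw [Finset.sum_comm]
    refine Finset.sum_congr rfl fun n hn => ?_
    have : ∀ σ : Fin k → Fin q, w σ * A (σ ∘ n) n =
        ∑ z, A z n * (w σ * if σ ∘ n = z then 1 else 0) := by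
      intro σ
      simp [mul_comm]
    simp only [this]
    rw [Finset.sum_comm]
    refine Finset.sum_congr rfl fun z _ => ?_
    rw [← Finset.mul_sum, hmarg n hn]
  set B := ∑ n ∈ N, ∑ z, A z n * ∏ j, x (n j) (z j)
  have h3 : ∑ σ, w σ * ∑ n ∈ N, A (σ ∘ n) n < ∑ σ, w σ * B := by
    obtain ⟨σ, -, hσ⟩ : ∃ σ ∈ (Finset.univ : Finset (Fin k → Fin q)), 0 < w σ := by
      by_contra! h
      have := Finset.sum_nonpos h
      linarith
    exact Finset.sum_lt_sum (fun σ _ => mul_le_mul_of_nonneg_left (hcon σ).le (hw0 σ))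
      ⟨σ, Finset.mem_univ _, mul_lt_mul_of_pos_left (hcon σ) hσ⟩
  rw [h2, ← Finset.sum_mul, hw1, one_mul] at h3
  exact lt_irrefl _ h3

end Multilinear


/-! ### Proportions of maps [r] → [k] through given vertices. -/

section Counting

variable {k r : ℕ}

/-- The proportion of the maps `[r] → [k]` with a given property. -/
noncomputable def density (P : (Fin r → Fin k) → Prop) [DecidablePred P] : ℝ :=
  ((k : ℝ) ^ r)⁻¹ * (Finset.univ.filter P).card

theorem density_mono {P Q : (Fin r → Fin k) → Prop} [DecidablePred P] [DecidablePred Q]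
    (h : ∀ n, P n → Q n) : density P ≤ density Q := by
  unfold density
  have : (Finset.univ.filter P).card ≤ (Finset.univ.filter Q).card :=
    Finset.card_le_card fun n hn => by
      simp only [Finset.mem_filter, Finset.mem_univ, true_and] at hn ⊢
      exact h n hn
  gcongr

theorem density_exists_le {α : Type*} [Fintype α] {P : α → (Fin r → Fin k) → Prop}
    [∀ a, DecidablePred (P a)] [DecidablePred fun n => ∃ a, P a n] {δ : ℝ}
    (h : ∀ a, density (P a) ≤ δ) : density (fun n => ∃ a, P a n) ≤ Fintype.card α * δ := by
  classical
  have h1 : (Finset.univ.filter fun n => ∃ a, P a n) =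
      Finset.univ.biUnion fun a => Finset.univ.filter (P a) := by
    ext n
    simp
  calc density (fun n => ∃ a, P a n)
      ≤ ((k : ℝ) ^ r)⁻¹ * ∑ a, ((Finset.univ.filter (P a)).card : ℝ) := by
        unfold density
        rw [h1]
        refine mul_le_mul_of_nonneg_left ?_ (by positivity)
        exact_mod_cast Finset.card_biUnion_le
    _ = ∑ a, density (P a) := by rw [Finset.mul_sum]; rfl
    _ ≤ ∑ _a : α, δ := Finset.sum_le_sum fun a _ => h a
    _ = _ := by simp

theorem density_or_le (P Q : (Fin r → Fin k) → Prop) [DecidablePred P] [DecidablePred Q] :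
    density (fun n => P n ∨ Q n) ≤ density P + density Q := by
  classical
  unfold density
  rw [← mul_add]
  refine mul_le_mul_of_nonneg_left ?_ (by positivity)
  rw [Finset.filter_or]
  exact_mod_cast Finset.card_union_le _ _

theorem density_eq_sum (P : (Fin r → Fin k) → Prop) [DecidablePred P] :
    density P = ((k : ℝ) ^ r)⁻¹ * ∑ n, if P n then (1 : ℝ) else 0 := by
  simp [density]

theorem density_apply_eq (hk : 0 < k) (j : Fin r) (a : Fin k) :
    density (fun n : Fin r → Fin k => n j = a) = 1 / k := by
  have hk' : (k : ℝ) ≠ 0 := by exact_mod_cast hk.ne'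
  have h := sum_update_eq j fun n : Fin r → Fin k => if n j = a then (1 : ℝ) else 0
  simp at h
  rw [density]
  field_simp
  linarith

theorem density_apply_eq_and (hk : 0 < k) {j j' : Fin r} (hj : j ≠ j') (a b : Fin k) :
    density (fun n : Fin r → Fin k => n j = a ∧ n j' = b) = 1 / (k : ℝ) ^ 2 := by
  have hk' : (k : ℝ) ≠ 0 := by exact_mod_cast hk.ne'
  have h := sum_update_eq j fun n : Fin r → Fin k => if n j = a ∧ n j' = b then (1 : ℝ) else 0
  have h2 := density_apply_eq hk j' b
  have h3 : ∀ n : Fin r → Fin k, ∑ v, (if Function.update n j v j = a ∧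
      Function.update n j v j' = b then (1 : ℝ) else 0) = if n j' = b then 1 else 0 := by
    intro n
    simp only [Function.update_self, Function.update_of_ne hj.symm]
    by_cases hb : n j' = b <;> simp [hb]
  simp only [h3, Fintype.card_fin] at h
  rw [density_eq_sum] at h2 ⊢
  rw [h] at h2
  field_simp at h2 ⊢
  linarith

theorem density_exists_apply_eq_le (hk : 0 < k) (a : Fin k) :
    density (fun n : Fin r → Fin k => ∃ j, n j = a) ≤ r / k := by
  refine (density_exists_le fun j => (density_apply_eq hk j a).le).trans (le_of_eq ?_)
  rw [Fintype.card_fin]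
  ring

/-- This bounds the influence of the variables of non-singletons. The order k⁻², rather than k⁻¹, is
what makes a union bound over all q^k maps possible. -/
theorem density_two_le (hk : 0 < k) {a b : Fin k} (hab : a ≠ b) :
    density (fun n : Fin r → Fin k => ∃ p : Fin r × Fin r, n p.1 = a ∧ n p.2 = b) ≤
      (r : ℝ) ^ 2 / (k : ℝ) ^ 2 := by
  refine (density_exists_le (δ := 1 / (k : ℝ) ^ 2) fun p => ?_).trans (le_of_eq ?_)
  · by_cases hp : p.1 = p.2
    · have : density (fun n : Fin r → Fin k => n p.1 = a ∧ n p.2 = b) = 0 := by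
        rw [density_eq_sum, Finset.sum_eq_zero, mul_zero]
        intro n _
        rw [if_neg]
        rintro ⟨h1, h2⟩
        rw [hp] at h1
        exact hab (h1.symm.trans h2)
      rw [this]
      positivity
    · exact (density_apply_eq_and hk hp a b).le
  · rw [Fintype.card_prod, Fintype.card_fin]
    push_cast
    ring

theorem density_not_injective_le (hk : 0 < k)
    [DecidablePred fun n : Fin r → Fin k => ¬ Function.Injective n] :
    density (fun n : Fin r → Fin k => ¬ Function.Injective n) ≤ (r : ℝ) ^ 2 / k := by
  have hk' : (k : ℝ) ≠ 0 := by exact_mod_cast hk.ne'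
  have h1 : density (fun n : Fin r → Fin k => ¬ Function.Injective n) ≤
      density (fun n : Fin r → Fin k => ∃ p : Fin r × Fin r, ∃ a,
        p.1 ≠ p.2 ∧ n p.1 = a ∧ n p.2 = a) := by
    refine density_mono fun n hn => ?_
    simp only [Function.Injective] at hn
    push Not at hn
    obtain ⟨i, j, hij, hne⟩ := hn
    exact ⟨(i, j), n j, hne, hij, rfl⟩
  refine h1.trans ((density_exists_le (δ := 1 / (k : ℝ)) fun p => ?_).trans (le_of_eq ?_))
  · refine (density_exists_le (δ := 1 / (k : ℝ) ^ 2) fun a => ?_).trans (le_of_eq ?_)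
    · by_cases hp : p.1 = p.2
      · have : density (fun n : Fin r → Fin k => p.1 ≠ p.2 ∧ n p.1 = a ∧ n p.2 = a) = 0 := by
          rw [density_eq_sum, Finset.sum_eq_zero, mul_zero]
          intro n _
          rw [if_neg]
          exact fun h => h.1 hp
        rw [this]
        positivity
      · rw [← density_apply_eq_and hk hp a a]
        exact density_mono fun n h => h.2
    · rw [Fintype.card_fin]
      field_simp
  · rw [Fintype.card_prod, Fintype.card_fin]
    push_cast
    ring

theorem density_exists_mem_le (hk : 0 < k) (Y : Finset (Fin k)) :
    density (fun n : Fin r → Fin k => ∃ j, n j ∈ Y) ≤ r * Y.card / k := by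
  have h1 : density (fun n : Fin r → Fin k => ∃ j, n j ∈ Y) ≤
      density (fun n : Fin r → Fin k => ∃ a : Y, ∃ j, n j = a) :=
    density_mono fun n ⟨j, hj⟩ => ⟨⟨n j, hj⟩, j, rfl⟩
  refine h1.trans ((density_exists_le fun a : Y =>
    density_exists_apply_eq_le hk (a : Fin k)).trans (le_of_eq ?_))
  rw [Fintype.card_coe]
  ring

/-- Averages of bounded quantities over all maps and over most maps are close. -/
theorem abs_average_sub_le {P : (Fin r → Fin k) → Prop} [DecidablePred P]
    {f g : (Fin r → Fin k) → ℝ} {C : ℝ} (h : ∀ n, ¬ P n → f n = g n) (hC : ∀ n, P n → |f n - g n| ≤ C) :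
    |((k : ℝ) ^ r)⁻¹ * ∑ n, f n - ((k : ℝ) ^ r)⁻¹ * ∑ n, g n| ≤ C * density P := by
  rw [← mul_sub, ← Finset.sum_sub_distrib, abs_mul, abs_of_nonneg (by positivity), density_eq_sum,
    mul_left_comm, Finset.mul_sum (a := C)]
  refine mul_le_mul_of_nonneg_left ?_ (by positivity)
  refine (Finset.abs_sum_le_sum_abs _ _).trans (Finset.sum_le_sum fun n _ => ?_)
  by_cases hP : P n
  · simpa [hP] using hC n hP
  · simp [hP, h n hP]

end Counting


/-! ### Separation of the vertex variables from those of larger sets. -/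

section Setup

variable {k q r : ℕ}

/-- The integrand of the energy of a family of functions at a fractional partition. -/
def mix (F : (Fin r → Fin q) → Cube r r → ℝ) (φ : Fin q → unitInterval → ℝ) (x : Cube r r) : ℝ :=
  ∑ z, F z x * ∏ j, φ (z j) (x (single j))

theorem abs_mix_le {F : (Fin r → Fin q) → Cube r r → ℝ} {C : ℝ} (hF : ∀ z x, |F z x| ≤ C)
    {φ : Fin q → unitInterval → ℝ} (hφ : IsFractionalPartition φ) (x : Cube r r) :
    |mix F φ x| ≤ C :=
  abs_sum_mul_prod_le (x := fun j m => φ m (x (single j))) (fun _ _ => (hφ.2.1 _ _).1)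
    (fun _ => hφ.2.2 _) fun z => hF z x

theorem measurable_mix {F : (Fin r → Fin q) → Cube r r → ℝ} (hF : ∀ z, Measurable (F z))
    {φ : Fin q → unitInterval → ℝ} (hφ : IsFractionalPartition φ) : Measurable (mix F φ) :=
  Finset.measurable_fun_sum _ fun z _ => (hF z).mul <|
    Finset.measurable_fun_prod _ fun j _ => (hφ.1 (z j)).comp (measurable_pi_apply _)

theorem exists_isFractionalPartition [NeZero q] :
    ∃ φ : Fin q → unitInterval → ℝ, IsFractionalPartition φ :=
  ⟨fun m _ => if m = 0 then 1 else 0, fun _ => measurable_const,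
    fun m _ => by dsimp only; split_ifs <;> simp, fun _ => by simp⟩

/-- The coordinate of the sample that belongs to a vertex. -/
def vertex (hr : 1 ≤ r) (i : Fin k) : Subsets k r :=
  ⟨{i}, Finset.singleton_nonempty i, by simpa using hr⟩

theorem vertex_injective (hr : 1 ≤ r) : Function.Injective (vertex (k := k) hr) := fun i j h => by
  simpa [vertex] using h

theorem imageSubset_single (hr : 1 ≤ r) (n : Fin r → Fin k) (j : Fin r) :
    imageSubset n (single j) = vertex hr (n j) := by
  simp [imageSubset, single, vertex]

theorem imageSubset_injective {n : Fin r → Fin k} (hn : Function.Injective n) :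
    Function.Injective (imageSubset n) := fun S T h => by
  rw [imageSubset, imageSubset, Subtype.mk.injEq] at h
  exact Subtype.ext (Finset.image_injective hn h)

theorem card_subsets_le : Fintype.card (Subsets r r) ≤ 2 ^ r := by
  refine (Fintype.card_subtype_le _).trans ?_
  simp

/-- The point whose singleton coordinates are given by `x` and the others by `V`. -/
def merge (x : Fin r → unitInterval) (V : Cube r r) : Cube r r :=
  fun S => if S.1.card = 1 then x (S.1.min' S.2.1) else V S

theorem merge_single (x : Fin r → unitInterval) (V : Cube r r) (j : Fin r) :
    merge x V (single j) = x j := by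
  simp [merge, single]

theorem measurePreserving_merge :
    MeasurePreserving (fun p : (Fin r → unitInterval) × Cube r r => merge p.1 p.2)
      volume volume := by
  have hg : Function.Injective (fun S : Subsets r r =>
      if S.1.card = 1 then Sum.inl (S.1.min' S.2.1) else Sum.inr S :
        Subsets r r → Fin r ⊕ Subsets r r) := by
    intro S T h
    by_cases hS : S.1.card = 1 <;> by_cases hT : T.1.card = 1 <;> simp only [hS, hT, if_true,
      if_false, Sum.inl.injEq, Sum.inr.injEq, reduceCtorEq] at h
    · obtain ⟨a, ha⟩ := Finset.card_eq_one.1 hS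
      obtain ⟨b, hb⟩ := Finset.card_eq_one.1 hT
      simp only [ha, hb, Finset.min'_singleton] at h
      exact Subtype.ext (by rw [ha, hb, h])
    · exact h
  have h := measurePreserving_sumElim (Ω := unitInterval) hg
  have heq : (fun p : (Fin r → unitInterval) × Cube r r => merge p.1 p.2) = fun p S =>
      Sum.elim p.1 p.2 (if S.1.card = 1 then Sum.inl (S.1.min' S.2.1) else Sum.inr S) := by
    funext p S
    by_cases hS : S.1.card = 1 <;> simp [merge, hS]
  rw [heq]
  exact h

theorem measurable_merge (x : Fin r → unitInterval) : Measurable (merge x) :=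
  measurePreserving_merge.measurable.comp (measurable_const.prodMk measurable_id)

/-- The average of `F z` over the coordinates of the non-singletons. -/
noncomputable def vertexKernel (F : (Fin r → Fin q) → Cube r r → ℝ) (z : Fin r → Fin q)
    (x : Fin r → unitInterval) : ℝ :=
  ∫ V : Cube r r, F z (merge x V)

theorem measurable_vertexKernel {F : (Fin r → Fin q) → Cube r r → ℝ}
    (hF : ∀ z, Measurable (F z)) (z : Fin r → Fin q) : Measurable (vertexKernel F z) :=
  (((hF z).comp measurePreserving_merge.measurable).stronglyMeasurable.integral_prod_right'
    (ν := (volume : Measure (Cube r r)))).measurable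

theorem abs_vertexKernel_le {F : (Fin r → Fin q) → Cube r r → ℝ} {C : ℝ}
    (hF : ∀ z x, |F z x| ≤ C) (z : Fin r → Fin q) (x : Fin r → unitInterval) :
    |vertexKernel F z x| ≤ C :=
  abs_integral_le_of_abs_le fun _ => hF _ _

/-- The integrand of the energy of a family of kernels on the vertices. -/
def vertexMix (H : (Fin r → Fin q) → (Fin r → unitInterval) → ℝ) (φ : Fin q → unitInterval → ℝ)
    (x : Fin r → unitInterval) : ℝ :=
  ∑ z, H z x * ∏ j, φ (z j) (x j)

theorem abs_vertexMix_le {H : (Fin r → Fin q) → (Fin r → unitInterval) → ℝ} {C : ℝ}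
    (hH : ∀ z x, |H z x| ≤ C) {φ : Fin q → unitInterval → ℝ} (hφ : IsFractionalPartition φ)
    (x : Fin r → unitInterval) : |vertexMix H φ x| ≤ C :=
  abs_sum_mul_prod_le (x := fun j m => φ m (x j)) (fun _ _ => (hφ.2.1 _ _).1)
    (fun _ => hφ.2.2 _) fun z => hH z x

theorem measurable_vertexMix {H : (Fin r → Fin q) → (Fin r → unitInterval) → ℝ}
    (hH : ∀ z, Measurable (H z)) {φ : Fin q → unitInterval → ℝ} (hφ : IsFractionalPartition φ) :
    Measurable (vertexMix H φ) :=
  Finset.measurable_fun_sum _ fun z _ => (hH z).mul <|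
    Finset.measurable_fun_prod _ fun j _ => (hφ.1 (z j)).comp (measurable_pi_apply _)

/-- Fubini: fractional partitions only see the singleton coordinates, so the others can be
integrated out beforehand. -/
theorem integral_vertexMix_vertexKernel {F : (Fin r → Fin q) → Cube r r → ℝ}
    (hF : ∀ z, Measurable (F z)) {C : ℝ} (hC : ∀ z x, |F z x| ≤ C)
    {φ : Fin q → unitInterval → ℝ} (hφ : IsFractionalPartition φ) :
    ∫ x, vertexMix (vertexKernel F) φ x = ∫ x, mix F φ x := by
  have hm := measurable_mix hF hφ
  rw [← integral_comp_measurePreserving measurePreserving_merge hm, Measure.volume_eq_prod,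
    integral_prod]
  · refine integral_congr_ae (ae_of_all _ fun x => ?_)
    simp only [vertexMix, mix, merge_single, vertexKernel]
    rw [integral_finsetSum]
    · simp only [integral_mul_const]
    · intro z _
      refine Integrable.mul_const ?_ _
      exact integrable_of_measurable_of_abs_le ((hF z).comp (measurable_merge x)) fun _ => hC _ _
  · exact integrable_of_measurable_of_abs_le (hm.comp measurePreserving_merge.measurable)
      fun _ => abs_mix_le hC hφ _

end Setup

/-! ### Concentration for a fixed partition, and for all maps over the non-singletons. -/

section Concentration

variable {k q r : ℕ}

/-- The injective maps `[r] → [k]`. -/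
noncomputable def injMaps (r k : ℕ) : Finset (Fin r → Fin k) :=
  open Classical in Finset.univ.filter Function.Injective

theorem mem_injMaps {n : Fin r → Fin k} : n ∈ injMaps r k ↔ Function.Injective n := by
  simp [injMaps]

theorem inv_pow_mul_card_le (N : Finset (Fin r → Fin k)) : ((k : ℝ) ^ r)⁻¹ * N.card ≤ 1 := by
  have h : N.card ≤ k ^ r := by simpa using Finset.card_le_univ N
  have h' : (N.card : ℝ) ≤ (k : ℝ) ^ r := by exact_mod_cast h
  exact (mul_le_mul_of_nonneg_left h' (by positivity)).trans inv_mul_le_one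

theorem inv_pow_mul_card_filter_le_density (N : Finset (Fin r → Fin k))
    (P Q : (Fin r → Fin k) → Prop) [DecidablePred P] [DecidablePred Q] (h : ∀ n, P n → Q n) :
    ((k : ℝ) ^ r)⁻¹ * (N.filter P).card ≤ density Q := by
  unfold density
  have : (N.filter P).card ≤ (Finset.univ.filter Q).card :=
    Finset.card_le_card fun n hn => by
      simp only [Finset.mem_filter, Finset.mem_univ, true_and] at hn ⊢
      exact h n hn.2
  gcongr

/-- The coordinates of the sample that are used by the edge `n`. -/
def edgeCoords (n : Fin r → Fin k) : Finset (Subsets k r) :=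
  Finset.univ.image (imageSubset n)

theorem card_edgeCoords_le (n : Fin r → Fin k) : ((edgeCoords n).card : ℝ) ≤ 2 ^ r := by
  have : (edgeCoords n).card ≤ 2 ^ r := Finset.card_image_le.trans (by simpa using card_subsets_le)
  exact_mod_cast this

theorem comp_imageSubset_update {n : Fin r → Fin k} {T : Subsets k r} (hT : T ∉ edgeCoords n)
    (U : Cube k r) (w : unitInterval) :
    (fun S => Function.update U T w (imageSubset n S)) = fun S => U (imageSubset n S) := by
  funext S
  refine Function.update_of_ne (fun h => hT ?_) _ _
  exact h ▸ Finset.mem_image_of_mem _ (Finset.mem_univ S)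

theorem exists_apply_eq_of_mem_edgeCoords {n : Fin r → Fin k} {T : Subsets k r}
    (hT : T ∈ edgeCoords n) {a : Fin k} (ha : a ∈ T.1) : ∃ j, n j = a := by
  obtain ⟨S, -, rfl⟩ := Finset.mem_image.1 hT
  obtain ⟨j, -, hj⟩ := Finset.mem_image.1 ha
  exact ⟨j, hj⟩

theorem measurable_comp_imageSubset {f : Cube r r → ℝ} (hf : Measurable f) (n : Fin r → Fin k) :
    Measurable fun U : Cube k r => f fun S => U (imageSubset n S) :=
  hf.comp (measurable_pi_lambda _ fun _ => measurable_pi_apply _)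

/-- The sampled average of a bounded function on the cube is not much smaller than its mean. -/
theorem measure_average_lt_le (hk : 0 < k) (hr : 1 ≤ r) {f : Cube r r → ℝ} (hf : Measurable f)
    (hf1 : ∀ x, |f x| ≤ 1) {s : ℝ} (hs : 0 ≤ s) :
    (volume : Measure (Cube k r)).real {U | ((k : ℝ) ^ r)⁻¹ *
      ∑ n ∈ injMaps r k, f (fun S => U (imageSubset n S)) ≤ (∫ x, f x) - r ^ 2 / k - s} ≤
      Real.exp (-(s ^ 2 / (8 * (r / k) * 2 ^ r))) := by
  classical
  have hk' : (0 : ℝ) < k := by exact_mod_cast hk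
  have hr' : (0 : ℝ) < r := by exact_mod_cast hr
  -- The upper tail for -f is the lower tail for f. Every coordinate has a vertex `a`, so it
  -- influences at most the proportion r/k of edges through `a`.
  have h := measure_avgOver_sum_add_le_le (ι := Subsets k r) (Ω := unitInterval) (injMaps r k)
    (g := fun n U => - f fun S => U (imageSubset n S))
    (fun n _ => (measurable_comp_imageSubset hf n).neg)
    (fun n _ U => by rw [abs_neg]; exact hf1 _) edgeCoords (I := Finset.univ)
    (fun n _ T _ hT U w => by rw [comp_imageSubset_update hT])
    (w := ((k : ℝ) ^ r)⁻¹) (a := r / k) (d := 2 ^ r) (by positivity) (inv_pow_mul_card_le _)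
    (by positivity) (by positivity)
    (fun T _ => by
      obtain ⟨a, ha⟩ := T.2.1
      exact (inv_pow_mul_card_filter_le_density _ _ (fun n => ∃ j, n j = a)
        fun n hn => exists_apply_eq_of_mem_edgeCoords hn ha).trans
        (density_exists_apply_eq_le hk a)) (fun n _ => card_edgeCoords_le n) hs
  refine le_trans (measureReal_mono ?_) h
  intro U hU
  simp only [Set.mem_ofPred_eq, Finset.sum_neg_distrib, mul_neg] at hU ⊢
  rw [avgOver_univ]
  have hint : ∫ U : Cube k r, -(((k : ℝ) ^ r)⁻¹ * ∑ n ∈ injMaps r k,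
      f fun S => U (imageSubset n S)) = -(((k : ℝ) ^ r)⁻¹ * ∑ n ∈ injMaps r k, ∫ x, f x) := by
    rw [integral_neg, integral_const_mul, integral_finsetSum]
    · congr 2
      refine Finset.sum_congr rfl fun n hn => ?_
      exact integral_comp_measurePreserving (measurePreserving_comp_injective
        (imageSubset_injective (mem_injMaps.1 hn))) hf
    · exact fun n _ => integrable_of_measurable_of_abs_le (measurable_comp_imageSubset hf n)
        fun _ => hf1 _
  rw [hint]
  have hI := abs_integral_le_of_abs_le (μ := (volume : Measure (Cube r r))) hf1
  have h1 := abs_average_sub_le (k := k) (r := r) (P := fun n => ¬ Function.Injective n)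
    (f := fun n => if n ∈ injMaps r k then ∫ x, f x else 0) (g := fun _ => ∫ x, f x) (C := 1)
    (fun n hn => if_pos (mem_injMaps.2 (not_not.1 hn)))
    (fun n hn => by
      rw [if_neg fun h => hn (mem_injMaps.1 h), zero_sub, abs_neg]
      exact hI)
  have h2 := density_not_injective_le (k := k) (r := r) hk
  have h3 : ((k : ℝ) ^ r)⁻¹ * ∑ _n : Fin r → Fin k, ∫ x, f x = ∫ x, f x := by
    simp only [Finset.sum_const, Finset.card_univ, Fintype.card_fun, Fintype.card_fin,
      nsmul_eq_mul]
    push_cast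
    field_simp
  rw [h3, Finset.sum_ite_mem, Finset.univ_inter, one_mul] at h1
  have := (abs_le.1 (h1.trans h2)).1
  linarith

/-- An injective edge preserves cardinalities, so resampling the non-singletons of the sample
resamples exactly the non-singleton arguments of that edge. -/
theorem comp_piecewise_imageSubset (hr : 1 ≤ r) {n : Fin r → Fin k} (hn : Function.Injective n)
    (U V : Cube k r) :
    (fun S => (Finset.univ.filter fun T : Subsets k r => T.1.card ≠ 1).piecewise V U
      (imageSubset n S)) =
      merge (fun j => U (vertex hr (n j))) fun S => V (imageSubset n S) := by
  funext S
  have hcard : (imageSubset n S).1.card = S.1.card := Finset.card_image_of_injective _ hn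
  by_cases hS : S.1.card = 1
  · rw [Finset.piecewise_eq_of_notMem _ _ _ (by simp [hcard, hS]), merge, if_pos hS]
    obtain ⟨j, hj⟩ := Finset.card_eq_one.1 hS
    obtain rfl : S = single j := Subtype.ext hj
    rw [imageSubset_single hr]
    simp [single]
  · rw [Finset.piecewise_eq_of_mem _ _ _ (by simp [hcard, hS]), merge, if_neg hS]

/-- For every assignment, averaging out the coordinates of the non-singletons changes the energy
by little, except on a very small event. -/
theorem measure_exists_vertexKernel_add_le (hk : 0 < k) (hr : 1 ≤ r)
    {F : (Fin r → Fin q) → Cube r r → ℝ} (hF : ∀ z, Measurable (F z))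
    (hF1 : ∀ z x, |F z x| ≤ 1) {s : ℝ} (hs : 0 ≤ s) :
    (volume : Measure (Cube k r)).real {U | ∃ σ : Fin k → Fin q, ((k : ℝ) ^ r)⁻¹ *
      ∑ n ∈ injMaps r k, vertexKernel F (σ ∘ n) (fun j => U (vertex hr (n j))) + s ≤
        ((k : ℝ) ^ r)⁻¹ * ∑ n ∈ injMaps r k, F (σ ∘ n) (fun S => U (imageSubset n S))} ≤
      q ^ k * Real.exp (-(s ^ 2 / (8 * (r ^ 2 / k ^ 2) * 2 ^ r))) := by
  classical
  have hk' : (0 : ℝ) < k := by exact_mod_cast hk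
  have hr' : (0 : ℝ) < r := by exact_mod_cast hr
  have h : ∀ σ : Fin k → Fin q, (volume : Measure (Cube k r)).real {U | ((k : ℝ) ^ r)⁻¹ *
      ∑ n ∈ injMaps r k, vertexKernel F (σ ∘ n) (fun j => U (vertex hr (n j))) + s ≤
        ((k : ℝ) ^ r)⁻¹ * ∑ n ∈ injMaps r k, F (σ ∘ n) (fun S => U (imageSubset n S))} ≤
      Real.exp (-(s ^ 2 / (8 * (r ^ 2 / k ^ 2) * 2 ^ r))) := by
    intro σ
    -- Only non-singletons are averaged. Each contains two distinct vertices, so its influence is at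
    -- most r²/k² and the exponent is of order s²k².
    have h := measure_avgOver_sum_add_le_le (ι := Subsets k r) (Ω := unitInterval) (injMaps r k)
      (g := fun n U => F (σ ∘ n) fun S => U (imageSubset n S))
      (fun n _ => measurable_comp_imageSubset (hF _) n) (fun n _ U => hF1 _ _) edgeCoords
      (I := Finset.univ.filter fun T : Subsets k r => T.1.card ≠ 1)
      (fun n _ T _ hT U w => by rw [comp_imageSubset_update hT])
      (w := ((k : ℝ) ^ r)⁻¹) (a := r ^ 2 / k ^ 2) (d := 2 ^ r) (by positivity)
      (inv_pow_mul_card_le _) (by positivity) (by positivity)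
      (fun T hT => by
        have hT1 : 1 < T.1.card :=
          lt_of_le_of_ne (Finset.card_pos.2 T.2.1) (Ne.symm (Finset.mem_filter.1 hT).2)
        obtain ⟨a, ha, b, hb, hab⟩ := Finset.one_lt_card.1 hT1
        refine (inv_pow_mul_card_filter_le_density _ _
          (fun n => ∃ p : Fin r × Fin r, n p.1 = a ∧ n p.2 = b) fun n hn => ?_).trans
          (density_two_le hk hab)
        obtain ⟨i, hi⟩ := exists_apply_eq_of_mem_edgeCoords hn ha
        obtain ⟨j, hj⟩ := exists_apply_eq_of_mem_edgeCoords hn hb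
        exact ⟨(i, j), hi, hj⟩) (fun n _ => card_edgeCoords_le n) hs
    refine le_trans (measureReal_mono ?_) h
    intro U hU
    simp only [Set.mem_ofPred_eq] at hU ⊢
    convert hU using 2
    unfold avgOver
    have hpm : ∀ n, Measurable fun V : Cube k r => F (σ ∘ n) fun S => (Finset.univ.filter
        fun T : Subsets k r => T.1.card ≠ 1).piecewise V U (imageSubset n S) := fun n =>
      (measurable_comp_imageSubset (hF _) n).comp ((measurable_piecewise_prod _).comp
        (measurable_const.prodMk measurable_id))
    rw [integral_const_mul, integral_finsetSum]
    · congr 1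
      refine Finset.sum_congr rfl fun n hn => ?_
      have hn' := mem_injMaps.1 hn
      simp only [comp_piecewise_imageSubset hr hn']
      exact integral_comp_measurePreserving (measurePreserving_comp_injective
        (imageSubset_injective hn')) (f := fun V : Cube r r => F (σ ∘ n) (merge _ V))
        ((hF _).comp (measurable_merge _))
    · exact fun n _ => integrable_of_measurable_of_abs_le (hpm n) fun _ => hF1 _ _
  have hset : {U : Cube k r | ∃ σ : Fin k → Fin q, ((k : ℝ) ^ r)⁻¹ *
      ∑ n ∈ injMaps r k, vertexKernel F (σ ∘ n) (fun j => U (vertex hr (n j))) + s ≤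
        ((k : ℝ) ^ r)⁻¹ * ∑ n ∈ injMaps r k, F (σ ∘ n) (fun S => U (imageSubset n S))} =
      ⋃ σ : Fin k → Fin q, {U | ((k : ℝ) ^ r)⁻¹ *
      ∑ n ∈ injMaps r k, vertexKernel F (σ ∘ n) (fun j => U (vertex hr (n j))) + s ≤
        ((k : ℝ) ^ r)⁻¹ * ∑ n ∈ injMaps r k, F (σ ∘ n) (fun S => U (imageSubset n S))} := by
    ext U
    simp
  rw [hset]
  refine (measureReal_iUnion_fintype_le _).trans ((Finset.sum_le_sum fun σ _ => h σ).trans ?_)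
  simp

end Concentration


/-! ### Fractional partitions built from the sample, uniformly over all lists of tests. -/

section SamplePartition

variable {k q r t : ℕ}

/-- The total score of a list of tests that are built from the sample `X`. -/
def sampleScore (H : (Fin r → Fin q) → (Fin r → unitInterval) → ℝ) (η : ℝ)
    (c : Fin t → Option (Test r q k)) (X : Fin k → unitInterval) (v : unitInterval) (m : Fin q) :
    ℝ :=
  totalScore η (fun (τ : Test r q k) (x : unitInterval × Fin q) =>
    H (Function.update τ.1 τ.2.1 x.2) (Function.update (X ∘ τ.2.2) τ.2.1 x.1)) c (v, m)

/-- The fractional partition of `[0,1]` given by the exponential weights of a list of tests that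
are built from the sample `X`. -/
noncomputable def samplePartition (H : (Fin r → Fin q) → (Fin r → unitInterval) → ℝ) (η : ℝ)
    (c : Fin t → Option (Test r q k)) (X : Fin k → unitInterval) (m : Fin q) (v : unitInterval) :
    ℝ :=
  softmax (sampleScore H η c X v) m

theorem measurable_sampleScore {H : (Fin r → Fin q) → (Fin r → unitInterval) → ℝ}
    (hH : ∀ z, Measurable (H z)) (η : ℝ) (c : Fin t → Option (Test r q k)) (m : Fin q) :
    Measurable fun x : (Fin k → unitInterval) × unitInterval =>
      sampleScore H η c x.1 x.2 m := by
  refine Measurable.const_mul (Finset.measurable_fun_sum _ fun i _ => ?_) η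
  rcases c i with _ | τ
  · exact measurable_const
  · have hu : Measurable fun x : (Fin k → unitInterval) × unitInterval =>
        Function.update (x.1 ∘ τ.2.2) τ.2.1 x.2 := by
      rw [measurable_pi_iff]
      intro j
      by_cases hj : j = τ.2.1
      · subst hj
        simp only [Function.update_self]
        exact measurable_snd
      · simp only [Function.update_of_ne hj, Function.comp]
        fun_prop
    exact (hH (Function.update τ.1 τ.2.1 m)).comp hu

theorem measurable_samplePartition {H : (Fin r → Fin q) → (Fin r → unitInterval) → ℝ}
    (hH : ∀ z, Measurable (H z)) (η : ℝ) (c : Fin t → Option (Test r q k)) (m : Fin q) :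
    Measurable fun x : (Fin k → unitInterval) × unitInterval =>
      samplePartition H η c x.1 m x.2 :=
  (Real.measurable_exp.comp (measurable_sampleScore hH η c m)).div
    (Finset.measurable_fun_sum _ fun l _ =>
      Real.measurable_exp.comp (measurable_sampleScore hH η c l))

theorem isFractionalPartition_samplePartition [NeZero q]
    {H : (Fin r → Fin q) → (Fin r → unitInterval) → ℝ} (hH : ∀ z, Measurable (H z)) (η : ℝ)
    (c : Fin t → Option (Test r q k)) (X : Fin k → unitInterval) :
    IsFractionalPartition (samplePartition H η c X) := by
  have h0 : ∀ m v, 0 ≤ samplePartition H η c X m v := fun m v =>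
    softmax_nonneg (sampleScore H η c X v) m
  have h1 : ∀ v, ∑ m, samplePartition H η c X m v = 1 := fun v =>
    sum_softmax (sampleScore H η c X v)
  refine ⟨fun m => ?_, fun m v => ⟨h0 m v, ?_⟩, h1⟩
  · exact (measurable_samplePartition hH η c m).comp
      (g := fun x : (Fin k → unitInterval) × unitInterval => samplePartition H η c x.1 m x.2)
      (f := fun v => (X, v)) (by fun_prop)
  · rw [← h1 v]
    exact Finset.single_le_sum (f := fun m => samplePartition H η c X m v) (fun m _ => h0 m v)
      (Finset.mem_univ m)

/-- The vertices that occur in a list of tests. -/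
def testVertices (c : Fin t → Option (Test r q k)) : Finset (Fin k) :=
  Finset.univ.biUnion fun i => (c i).elim ∅ fun τ => Finset.univ.image τ.2.2

theorem card_testVertices_le (c : Fin t → Option (Test r q k)) :
    (testVertices c).card ≤ t * r := by
  refine Finset.card_biUnion_le.trans ((Finset.sum_le_card_nsmul _ _ r fun i _ => ?_).trans ?_)
  · rcases c i with _ | τ
    · simp
    · exact Finset.card_image_le.trans (by simp)
  · simp

/-- With the vertices of the tests held fixed, the partition is deterministic while the remaining
vertices stay independent of it. -/
theorem samplePartition_congr (H : (Fin r → Fin q) → (Fin r → unitInterval) → ℝ) (η : ℝ)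
    (c : Fin t → Option (Test r q k)) {X X' : Fin k → unitInterval}
    (h : ∀ i ∈ testVertices c, X i = X' i) :
    samplePartition H η c X = samplePartition H η c X' := by
  funext m v
  unfold samplePartition sampleScore totalScore
  congr 1
  funext m
  congr 1
  refine Finset.sum_congr rfl fun i _ => ?_
  rcases hc : c i with _ | τ
  · rfl
  · have : X ∘ τ.2.2 = X' ∘ τ.2.2 := by
      funext j
      refine h _ (Finset.mem_biUnion.2 ⟨i, Finset.mem_univ i, ?_⟩)
      rw [hc]
      exact Finset.mem_image_of_mem _ (Finset.mem_univ j)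
    simp only [Option.elim, this]

/-- For all lists of tests at once, the energy of the resulting fractional partition on the sample
is not much larger than its energy on the continuum, except on a small event. -/
theorem measure_exists_samplePartition_le [NeZero q] (hk : 0 < k) (hr : 1 ≤ r)
    {H : (Fin r → Fin q) → (Fin r → unitInterval) → ℝ} (hH : ∀ z, Measurable (H z))
    (hH1 : ∀ z x, |H z x| ≤ 1) (η : ℝ) (t : ℕ) {s : ℝ} (hs : 0 ≤ s) :
    (volume : Measure (Fin k → unitInterval)).real {X | ∃ c : Fin t → Option (Test r q k),
      (∫ x, vertexMix H (samplePartition H η c X) x) + 2 * (r ^ 2 * (t + 1) / k) + s ≤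
        ((k : ℝ) ^ r)⁻¹ * ∑ n : Fin r → Fin k, vertexMix H (samplePartition H η c X) (X ∘ n)} ≤
      (q ^ r * (r * k ^ r) + 1) ^ t * Real.exp (-(s ^ 2 / (8 * (r / k) * r))) := by
  classical
  have hk' : (0 : ℝ) < k := by exact_mod_cast hk
  have hr' : (0 : ℝ) < r := by exact_mod_cast hr
  have hpart := fun c X => isFractionalPartition_samplePartition (k := k) (t := t) hH η c X
  have h : ∀ c : Fin t → Option (Test r q k),
      (volume : Measure (Fin k → unitInterval)).real {X |
      (∫ x, vertexMix H (samplePartition H η c X) x) + 2 * (r ^ 2 * (t + 1) / k) + s ≤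
        ((k : ℝ) ^ r)⁻¹ * ∑ n : Fin r → Fin k, vertexMix H (samplePartition H η c X) (X ∘ n)} ≤
      Real.exp (-(s ^ 2 / (8 * (r / k) * r))) := by
    intro c
    have hgm : ∀ n : Fin r → Fin k, Measurable fun X : Fin k → unitInterval =>
        vertexMix H (samplePartition H η c X) (X ∘ n) := fun n =>
      Finset.measurable_fun_sum _ fun z _ => by
        refine Measurable.mul ((hH z).comp (by fun_prop)) ?_
        refine Finset.measurable_fun_prod _ fun j _ => ?_
        exact (measurable_samplePartition hH η c (z j)).comp
          (g := fun x : (Fin k → unitInterval) × unitInterval => samplePartition H η c x.1 (z j) x.2)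
          (f := fun X : Fin k → unitInterval => (X, X (n j))) (by fun_prop)
    have hg1 : ∀ (n : Fin r → Fin k) (X : Fin k → unitInterval),
        |vertexMix H (samplePartition H η c X) (X ∘ n)| ≤ 1 := fun n X =>
      abs_vertexMix_le hH1 (hpart c X) _
    have h := measure_avgOver_sum_add_le_le (ι := Fin k) (Ω := unitInterval)
      (Finset.univ : Finset (Fin r → Fin k)) (fun n _ => hgm n) (fun n _ => hg1 n)
      (fun n => Finset.univ.image n) (I := (testVertices c)ᶜ)
      (fun n _ i hi hin X w => by
        have h1 : samplePartition H η c (Function.update X i w) = samplePartition H η c X :=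
          samplePartition_congr H η c fun l hl => Function.update_of_ne
            (ne_of_mem_of_not_mem hl (Finset.mem_compl.1 hi)) _ _
        have h2 : Function.update X i w ∘ n = X ∘ n := by
          funext j
          refine Function.update_of_ne (fun h => hin ?_) _ _
          exact h ▸ Finset.mem_image_of_mem _ (Finset.mem_univ j)
        rw [h1, h2])
      (w := ((k : ℝ) ^ r)⁻¹) (a := r / k) (d := r) (by positivity) (inv_pow_mul_card_le _)
      (by positivity) (by positivity)
      (fun i _ => (inv_pow_mul_card_filter_le_density _ _ (fun n => ∃ j, n j = i)
        fun n hn => by simpa using hn).trans (density_exists_apply_eq_le hk i))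
      (fun n _ => by exact_mod_cast Finset.card_image_le.trans (by simp)) hs
    refine le_trans (measureReal_mono ?_) h
    intro X hX
    simp only [Set.mem_ofPred_eq] at hX ⊢
    refine le_trans ?_ hX
    set e : ℝ := ∫ x, vertexMix H (samplePartition H η c X) x with he
    have he1 : |e| ≤ 1 := abs_integral_le_of_abs_le fun x => abs_vertexMix_le hH1 (hpart c X) x
    have hcongr : ∀ Y : Fin k → unitInterval,
        samplePartition H η c ((testVertices c)ᶜ.piecewise Y X) = samplePartition H η c X :=
      fun Y => samplePartition_congr H η c fun i hi =>
        Finset.piecewise_eq_of_notMem _ _ _ (by simpa using hi)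
    have havg : avgOver (testVertices c)ᶜ (fun X => ((k : ℝ) ^ r)⁻¹ *
        ∑ n : Fin r → Fin k, vertexMix H (samplePartition H η c X) (X ∘ n)) X =
        ((k : ℝ) ^ r)⁻¹ * ∑ n : Fin r → Fin k, avgOver (testVertices c)ᶜ
          (fun X => vertexMix H (samplePartition H η c X) (X ∘ n)) X := by
      unfold avgOver
      rw [integral_const_mul, integral_finsetSum]
      exact fun n _ => integrable_of_measurable_of_abs_le ((hgm n).comp
        ((measurable_piecewise_prod _).comp (measurable_const.prodMk measurable_id)))
        fun _ => hg1 _ _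
    -- An injective edge avoiding the test vertices has conditional mean exactly `e`. The other
    -- edges have density at most r²/k + r·(tr)/k, and each deviates by at most 2.
    have h1 := abs_average_sub_le (k := k) (r := r)
      (P := fun n => ¬ Function.Injective n ∨ ∃ j, n j ∈ testVertices c)
      (f := fun n => avgOver (testVertices c)ᶜ
          (fun X => vertexMix H (samplePartition H η c X) (X ∘ n)) X) (g := fun _ => e) (C := 2)
      (fun n hn => by
        push Not at hn
        simp only [avgOver, hcongr]
        have h2 : ∀ Y : Fin k → unitInterval,
            (testVertices c)ᶜ.piecewise Y X ∘ n = fun j => Y (n j) := fun Y => by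
          funext j
          exact Finset.piecewise_eq_of_mem _ _ _ (by simpa using hn.2 j)
        simp only [h2]
        exact integral_comp_measurePreserving (measurePreserving_comp_injective hn.1)
          (measurable_vertexMix hH (hpart c X)))
      (fun n _ => by
        have h2 := abs_le.1 (abs_avgOver_le (testVertices c)ᶜ (hg1 n) X)
        have h3 := abs_le.1 he1
        rw [abs_le]
        constructor <;> linarith)
    have h3 : ((k : ℝ) ^ r)⁻¹ * ∑ _n : Fin r → Fin k, e = e := by
      simp only [Finset.sum_const, Finset.card_univ, Fintype.card_fun, Fintype.card_fin,
        nsmul_eq_mul]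
      push_cast
      field_simp
    rw [h3] at h1
    have h4 : density (fun n : Fin r → Fin k =>
        ¬ Function.Injective n ∨ ∃ j, n j ∈ testVertices c) ≤ r ^ 2 * (t + 1) / k := by
      refine (density_or_le _ _).trans ((add_le_add (density_not_injective_le hk)
        (density_exists_mem_le hk _)).trans ?_)
      have h5 : ((testVertices c).card : ℝ) ≤ t * r := by exact_mod_cast card_testVertices_le c
      rw [← add_div]
      refine div_le_div_of_nonneg_right ?_ hk'.le
      nlinarith
    rw [havg]
    have := (abs_le.1 h1).2
    linarith
  have hset : {X : Fin k → unitInterval | ∃ c : Fin t → Option (Test r q k),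
      (∫ x, vertexMix H (samplePartition H η c X) x) + 2 * (r ^ 2 * (t + 1) / k) + s ≤
        ((k : ℝ) ^ r)⁻¹ * ∑ n : Fin r → Fin k, vertexMix H (samplePartition H η c X) (X ∘ n)} =
      ⋃ c : Fin t → Option (Test r q k), {X : Fin k → unitInterval |
      (∫ x, vertexMix H (samplePartition H η c X) x) + 2 * (r ^ 2 * (t + 1) / k) + s ≤
        ((k : ℝ) ^ r)⁻¹ *
          ∑ n : Fin r → Fin k, vertexMix H (samplePartition H η c X) (X ∘ n)} := by
    ext X
    simp
  rw [hset]
  -- Union bound over the lists: each of the t entries is `none` or one of q^r · r · k^r tests.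
  refine (measureReal_iUnion_fintype_le _).trans ((Finset.sum_le_sum fun c _ => h c).trans ?_)
  simp

end SamplePartition


/-! ### The tail bound for one family bounded by 1. -/

section Energies

variable {k q r : ℕ}

/-- The ground state energy of a family of functions on the cube. -/
noncomputable def supEnergy (F : (Fin r → Fin q) → Cube r r → ℝ) : ℝ :=
  sSup {v : ℝ | ∃ φ : Fin q → unitInterval → ℝ, IsFractionalPartition φ ∧ v = ∫ x, mix F φ x}

/-- The integer ground state energy of a family of arrays. -/
noncomputable def arrayEnergy (G : (Fin r → Fin q) → (Fin r → Fin k) → ℝ) : ℝ :=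
  ⨆ σ : Fin k → Fin q, ((k : ℝ) ^ r)⁻¹ * ∑ n, G (σ ∘ n) n

theorem integral_mix_le_supEnergy {F : (Fin r → Fin q) → Cube r r → ℝ} {C : ℝ}
    (hF : ∀ z x, |F z x| ≤ C) {φ : Fin q → unitInterval → ℝ} (hφ : IsFractionalPartition φ) :
    ∫ x, mix F φ x ≤ supEnergy F := by
  refine le_csSup ⟨C, ?_⟩ ⟨φ, hφ, rfl⟩
  rintro _ ⟨φ', hφ', rfl⟩
  exact (abs_le.1 (abs_integral_le_of_abs_le fun x => abs_mix_le hF hφ' x)).2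

theorem exists_supEnergy_lt [NeZero q] (F : (Fin r → Fin q) → Cube r r → ℝ) {δ : ℝ}
    (hδ : 0 < δ) : ∃ φ : Fin q → unitInterval → ℝ, IsFractionalPartition φ ∧
      supEnergy F - δ < ∫ x, mix F φ x := by
  obtain ⟨φ₀, hφ₀⟩ := exists_isFractionalPartition (q := q)
  obtain ⟨_, ⟨φ, hφ, rfl⟩, h⟩ := exists_lt_of_lt_csSup
    (s := {v : ℝ | ∃ φ : Fin q → unitInterval → ℝ,
      IsFractionalPartition φ ∧ v = ∫ x, mix F φ x}) ⟨_, φ₀, hφ₀, rfl⟩ (sub_lt_self _ hδ)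
  exact ⟨φ, hφ, h⟩

theorem le_arrayEnergy (G : (Fin r → Fin q) → (Fin r → Fin k) → ℝ) (σ : Fin k → Fin q) :
    ((k : ℝ) ^ r)⁻¹ * ∑ n, G (σ ∘ n) n ≤ arrayEnergy G :=
  le_ciSup (f := fun σ : Fin k → Fin q => ((k : ℝ) ^ r)⁻¹ * ∑ n, G (σ ∘ n) n)
    (Set.finite_range _).bddAbove σ

theorem multiform_eq_sum_vertexMix (H : (Fin r → Fin q) → (Fin r → unitInterval) → ℝ)
    (φ : Fin q → unitInterval → ℝ) (X : Fin k → unitInterval) :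
    multiform (fun z n => H z (X ∘ n)) (fun _ n m => φ m (X n)) =
      ∑ n : Fin r → Fin k, vertexMix H φ (X ∘ n) := rfl

/-- The softmax produced on the sample is the restriction to the points `X n` of a partition of all
of [0,1]. Accuracy δ/r per position gives δ in total. -/
theorem exists_samplePartition_ge (hk : 0 < k) (hr : 1 ≤ r) [NeZero q]
    {H : (Fin r → Fin q) → (Fin r → unitInterval) → ℝ} (hH1 : ∀ z x, |H z x| ≤ 1)
    (X : Fin k → unitInterval) (σ : Fin k → Fin q) {δ : ℝ} (hδ : 0 < δ) (hδ1 : δ ≤ 1) {t : ℕ}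
    (ht : 4 * Real.log q < t * (δ / r) ^ 2) :
    ∃ c : Fin t → Option (Test r q k), ((k : ℝ) ^ r)⁻¹ * ∑ n : Fin r → Fin k, H (σ ∘ n) (X ∘ n) ≤
      ((k : ℝ) ^ r)⁻¹ * ∑ n : Fin r → Fin k,
        vertexMix H (samplePartition H (δ / r / 2) c X) (X ∘ n) + δ := by
  have hr' : (1 : ℝ) ≤ r := by exact_mod_cast hr
  have hr0 : (0 : ℝ) < r := by linarith
  have hk' : (0 : ℝ) < (k : ℝ) ^ r := by positivity
  obtain ⟨c, hc⟩ := exists_softmax_multiform_le hk (fun z n => H z (X ∘ n)) (fun z n => hH1 z _) σ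
    (div_pos hδ hr0) (div_le_one_of_le₀ (hδ1.trans hr') hr0.le) ht
  refine ⟨c, ?_⟩
  have h1 : (fun (_ : Fin r) n => softmax fun m => totalScore (δ / r / 2)
      (fun (τ : Test r q k) (x : Fin k × Fin q) => H (Function.update τ.1 τ.2.1 x.2)
        (X ∘ Function.update τ.2.2 τ.2.1 x.1)) c (n, m)) =
      fun (_ : Fin r) n m => samplePartition H (δ / r / 2) c X m (X n) := by
    funext _ n m
    simp only [samplePartition, Function.comp_update]
    rfl
  rw [h1, multiform_eq_sum_vertexMix, mul_div_cancel₀ _ hr0.ne'] at hc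
  calc _ ≤ ((k : ℝ) ^ r)⁻¹ * (∑ n : Fin r → Fin k,
        vertexMix H (samplePartition H (δ / r / 2) c X) (X ∘ n) + k ^ r * δ) :=
        mul_le_mul_of_nonneg_left hc (by positivity)
    _ = _ := by field_simp

theorem abs_average_sub_average_injMaps_le (hk : 0 < k) {f g : (Fin r → Fin k) → ℝ}
    (h : ∀ n, Function.Injective n → f n = g n) (hf : ∀ n, |f n| ≤ 1) :
    |((k : ℝ) ^ r)⁻¹ * ∑ n, f n - ((k : ℝ) ^ r)⁻¹ * ∑ n ∈ injMaps r k, g n| ≤ r ^ 2 / k := by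
  classical
  have h1 := abs_average_sub_le (k := k) (r := r) (P := fun n => ¬ Function.Injective n)
    (f := f) (g := fun n => if n ∈ injMaps r k then g n else 0) (C := 1)
    (fun n hn => by
      rw [if_pos (mem_injMaps.2 (not_not.1 hn)), h n (not_not.1 hn)])
    (fun n hn => by
      rw [if_neg fun h => hn (mem_injMaps.1 h), sub_zero]
      exact hf n)
  rw [Finset.sum_ite_mem, Finset.univ_inter, one_mul] at h1
  exact h1.trans (density_not_injective_le hk)

/-- Only this inequality holds for arbitrary sets, and it makes measurability of the bad event
irrelevant when passing from vertex variables to the whole sample. -/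
theorem measureReal_preimage_le {α β : Type*} [MeasurableSpace α] [MeasurableSpace β]
    {μ : Measure α} {ν : Measure β} [IsFiniteMeasure ν] {T : α → β}
    (hT : MeasurePreserving T μ ν) (s : Set β) : μ.real (T ⁻¹' s) ≤ ν.real s := by
  refine ENNReal.toReal_mono (measure_ne_top _ _) ?_
  rw [← hT.map_eq]
  exact Measure.le_map_apply hT.aemeasurable s

/-- The tail bound for the sampled ground state energy of a family of functions bounded by one. -/
theorem measure_lt_abs_supEnergy_sub_arrayEnergy_le [NeZero q] (hk : 0 < k) (hr : 1 ≤ r)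
    {F : (Fin r → Fin q) → Cube r r → ℝ} (hF : ∀ z, Measurable (F z))
    (hF1 : ∀ z x, |F z x| ≤ 1) {ε : ℝ} (hε : 0 < ε) (hε1 : ε ≤ 1) {t : ℕ}
    (ht : 4 * Real.log q < t * (ε / 4 / r) ^ 2) (htk : 8 * r ^ 2 * (t + 2) ≤ ε * k) :
    (volume : Measure (Cube k r)).real {U | ∃ G : (Fin r → Fin q) → (Fin r → Fin k) → ℝ,
      (∀ z n, |G z n| ≤ 1) ∧
      (∀ z n, Function.Injective n → G z n = F z fun S => U (imageSubset n S)) ∧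
      ε < |supEnergy F - arrayEnergy G|} ≤
      Real.exp (-((ε / 4) ^ 2 / (8 * (r / k) * 2 ^ r))) +
      q ^ k * Real.exp (-((ε / 4) ^ 2 / (8 * (r ^ 2 / k ^ 2) * 2 ^ r))) +
      (q ^ r * (r * k ^ r) + 1) ^ t * Real.exp (-((ε / 4) ^ 2 / (8 * (r / k) * r))) := by
  have hk' : (0 : ℝ) < k := by exact_mod_cast hk
  have hδ : 0 < ε / 4 := by linarith
  obtain ⟨φ, hφ, hφE⟩ := exists_supEnergy_lt F hδ
  set H := vertexKernel F with hHdef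
  have hH := measurable_vertexKernel hF
  have hH1 := abs_vertexKernel_le hF1
  have hB1 := measure_average_lt_le hk hr (measurable_mix hF hφ) (abs_mix_le hF1 hφ) hδ.le
  have hB2 := measure_exists_vertexKernel_add_le hk hr hF hF1 hδ.le
  have hB3 := (measureReal_preimage_le (measurePreserving_comp_injective (Ω := unitInterval)
    (vertex_injective (k := k) hr)) _).trans
    (measure_exists_samplePartition_le hk hr hH hH1 (ε / 4 / r / 2) t hδ.le)
  refine le_trans (measureReal_mono ?_) ((measureReal_union_le _ _).trans
    (add_le_add ((measureReal_union_le _ _).trans (add_le_add hB1 hB2)) hB3))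
  rintro U ⟨G, hG1, hGF, hlt⟩
  by_contra hU
  simp only [Set.mem_union, not_or, Set.mem_preimage, Set.mem_ofPred_eq, not_exists, not_le] at hU
  obtain ⟨⟨hU1, hU2⟩, hU3⟩ := hU
  -- Error budget: all diagonal and test-vertex corrections take one quarter of ε. The upper bound
  -- spends the other three on `hU2`, the softmax approximation and `hU3`; the lower bound spends
  -- two, on the choice of φ and on `hU1`.
  have herr : (r : ℝ) ^ 2 / k + r ^ 2 / k + 2 * (r ^ 2 * (t + 1) / k) ≤ ε / 4 := by
    rw [← add_div, ← mul_div_assoc, ← add_div, div_le_iff₀ hk']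
    linarith
  have hnn : 0 ≤ (r : ℝ) ^ 2 * (t + 1) / k := by positivity
  have hG : ∀ σ : Fin k → Fin q, |((k : ℝ) ^ r)⁻¹ * ∑ n, G (σ ∘ n) n - ((k : ℝ) ^ r)⁻¹ *
      ∑ n ∈ injMaps r k, F (σ ∘ n) fun S => U (imageSubset n S)| ≤ r ^ 2 / k := fun σ =>
    abs_average_sub_average_injMaps_le hk (fun n hn => hGF _ n hn) fun n => hG1 _ n
  have hupper : arrayEnergy G ≤ supEnergy F + ε := by
    have : Nonempty (Fin k → Fin q) := ⟨fun _ => 0⟩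
    refine ciSup_le fun σ => ?_
    have h1 := (abs_le.1 (hG σ)).2
    have h2 := hU2 σ
    have h3 := (abs_le.1 (abs_average_sub_average_injMaps_le hk (r := r)
      (f := fun n => H (σ ∘ n) fun j => U (vertex hr (n j))) (fun n _ => rfl)
      fun n => hH1 _ _)).1
    obtain ⟨c, hc⟩ := exists_samplePartition_ge hk hr hH1 (fun i => U (vertex hr i)) σ hδ
      (by linarith) ht
    have h4 := hU3 c
    have h5 := integral_mix_le_supEnergy hF1
      (isFractionalPartition_samplePartition hH (ε / 4 / r / 2) c fun i => U (vertex hr i))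
    rw [← integral_vertexMix_vertexKernel hF hF1
      (isFractionalPartition_samplePartition hH _ c _)] at h5
    simp only [Function.comp_def] at hc h4 h3 h1 h2 ⊢
    linarith
  have hlower : supEnergy F - ε ≤ arrayEnergy G := by
    obtain ⟨σ, hσ⟩ := exists_le_sum_comp (fun z n => F z fun S => U (imageSubset n S))
      (x := fun i m => φ m (U (vertex hr i))) (fun i m => (hφ.2.1 _ _).1) (fun i => hφ.2.2 _)
      (N := injMaps r k) fun n hn => mem_injMaps.1 hn
    have h1 := (abs_le.1 (hG σ)).1
    have h2 := le_arrayEnergy G σ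
    have h3 : ∑ n ∈ injMaps r k, mix F φ (fun S => U (imageSubset n S)) ≤
        ∑ n ∈ injMaps r k, F (σ ∘ n) fun S => U (imageSubset n S) := by
      simpa only [mix, imageSubset_single hr] using hσ
    have h4 := mul_le_mul_of_nonneg_left h3 (by positivity : 0 ≤ ((k : ℝ) ^ r)⁻¹)
    linarith
  refine hlt.not_ge (abs_le.2 ⟨?_, ?_⟩) <;> linarith

end Energies


/-! ### The sample size and the error terms. -/

section Numerics

/-- The sample size from which on the error probabilities are small. -/
noncomputable def sampleSize (C : ℝ) (ε : ℝ) : ℕ :=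
  ⌈C * ε⁻¹ ^ 4 + 2 * (C * ε⁻¹ ^ 4) * Real.log (2 * (C * ε⁻¹ ^ 4))⌉₊

/-- This makes the implicit condition x ≥ B log x explicit: split x = (x/2B)·2B inside the logarithm
and use log y ≤ y - 1. -/
theorem mul_log_le_of_le {B x : ℝ} (hB : 0 < B) (hx : 0 < x)
    (h : 2 * B * Real.log (2 * B) ≤ x) : B * Real.log x ≤ x := by
  have h1 : Real.log x = Real.log (x / (2 * B)) + Real.log (2 * B) := by
    rw [Real.log_div hx.ne' (by positivity)]
    ring
  have h2 := Real.log_le_sub_one_of_pos (show 0 < x / (2 * B) by positivity)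
  have h3 : B * Real.log (x / (2 * B)) ≤ B * (x / (2 * B) - 1) :=
    mul_le_mul_of_nonneg_left h2 hB.le
  have h4 : B * (x / (2 * B) - 1) = x / 2 - B := by field_simp
  rw [h1, mul_add]
  linarith

theorem sampleSize_spec {C ε : ℝ} (hC : 1 ≤ C) (hε : 0 < ε) (hε1 : ε ≤ 1 / 2) {k : ℕ}
    (hk : sampleSize C ε ≤ k) :
    C * ε⁻¹ ^ 4 ≤ k ∧ C * ε⁻¹ ^ 4 * Real.log k ≤ k := by
  have hu : 1 ≤ ε⁻¹ := (one_le_inv₀ hε).2 (by linarith)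
  have hB : 1 ≤ C * ε⁻¹ ^ 4 := one_le_mul_of_one_le_of_one_le hC (one_le_pow₀ hu)
  have h1 := Nat.ceil_le.1 hk
  have h2 : 0 ≤ 2 * (C * ε⁻¹ ^ 4) * Real.log (2 * (C * ε⁻¹ ^ 4)) :=
    mul_nonneg (by linarith) (Real.log_nonneg (by linarith))
  have h3 : C * ε⁻¹ ^ 4 ≤ k := by linarith
  exact ⟨h3, mul_log_le_of_le (by linarith) (by linarith) (by linarith)⟩

theorem sampleSize_isBigO {C : ℝ} (hC : 1 ≤ C) :
    (fun ε : ℝ => (sampleSize C (min ε (1 / 2)) : ℝ)) =O[𝓝[>] 0]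
      fun ε : ℝ => ε⁻¹ ^ 4 * Real.log ε⁻¹ := by
  refine IsBigO.of_bound (2 * C + 2 * C * (2 * Real.log (2 * C) + 4) + 2) ?_
  have hmem : Set.Ioo (0 : ℝ) (1 / 2) ∈ 𝓝[>] (0 : ℝ) := Ioo_mem_nhdsGT (by norm_num)
  filter_upwards [hmem] with ε hε
  rw [min_eq_left hε.2.le]
  have hε0 : 0 < ε := hε.1
  have hu : 2 ≤ ε⁻¹ := by
    rw [le_inv_comm₀ (by norm_num) hε0]
    linarith [hε.2]
  set w := ε⁻¹ with hw
  -- Hence 1 ≤ 2 log w, which absorbs every term lacking a logarithm.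
  have hl : 1 / 2 ≤ Real.log w := by
    have := Real.log_le_log (by norm_num) hu
    linarith [Real.log_two_gt_d9]
  have hw4 : 1 ≤ w ^ 4 := one_le_pow₀ (by linarith)
  have hlog : Real.log (2 * (C * w ^ 4)) = Real.log (2 * C) + 4 * Real.log w := by
    rw [← mul_assoc, Real.log_mul (by positivity) (by positivity), Real.log_pow]
    norm_num
  have hl2C : 0 ≤ Real.log (2 * C) := Real.log_nonneg (by linarith)
  have hB : 1 ≤ C * w ^ 4 := one_le_mul_of_one_le_of_one_le hC hw4
  have h1 : (sampleSize C ε : ℝ) ≤ C * w ^ 4 + 2 * (C * w ^ 4) * Real.log (2 * (C * w ^ 4)) + 1 := by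
    refine (Nat.ceil_lt_add_one ?_).le
    have : 0 ≤ 2 * (C * w ^ 4) * Real.log (2 * (C * w ^ 4)) :=
      mul_nonneg (by linarith) (Real.log_nonneg (by linarith))
    linarith
  rw [Real.norm_of_nonneg (Nat.cast_nonneg _), Real.norm_of_nonneg (by positivity)]
  refine h1.trans ?_
  rw [hlog]
  have h2 : C * w ^ 4 ≤ C * w ^ 4 * (2 * Real.log w) :=
    le_mul_of_one_le_right (by linarith) (by linarith)
  have h3 : (1 : ℝ) ≤ w ^ 4 * (2 * Real.log w) :=
    one_le_mul_of_one_le_of_one_le hw4 (by linarith)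
  have h4 : Real.log (2 * C) ≤ Real.log (2 * C) * (2 * Real.log w) :=
    le_mul_of_one_le_right hl2C (by linarith)
  have h5 := mul_le_mul_of_nonneg_left h4 (by linarith : 0 ≤ 2 * (C * w ^ 4))
  linarith

/-- From the sample size on, all error terms are small. -/
theorem exists_constant_error_terms_lt (r q : ℕ) (hr : 1 ≤ r) (hq : 1 ≤ q) :
    ∃ C : ℝ, 1 ≤ C ∧ ∀ ε : ℝ, 0 < ε → ε ≤ 1 / 2 → ∀ k : ℕ, C * ε⁻¹ ^ 4 ≤ k →
      C * ε⁻¹ ^ 4 * Real.log k ≤ k → 0 < k ∧ ∃ t : ℕ, 4 * Real.log q < t * (ε / 4 / r) ^ 2 ∧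
        8 * (r : ℝ) ^ 2 * (t + 2) ≤ ε * k ∧
        Real.exp (-((ε / 4) ^ 2 / (8 * (r / k) * 2 ^ r))) +
        (q : ℝ) ^ k * Real.exp (-((ε / 4) ^ 2 / (8 * (r ^ 2 / k ^ 2) * 2 ^ r))) +
        ((q : ℝ) ^ r * (r * k ^ r) + 1) ^ t * Real.exp (-((ε / 4) ^ 2 / (8 * (r / k) * r)))
          < ε := by
  have hr' : (1 : ℝ) ≤ r := by exact_mod_cast hr
  have hq' : (1 : ℝ) ≤ q := by exact_mod_cast hq
  have hqr : (1 : ℝ) ≤ (q : ℝ) ^ r := one_le_pow₀ hq'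
  set C₁ : ℝ := 64 * r ^ 2 * q + 1 with hC₁
  have hC₁0 : 1 ≤ C₁ := by
    have : 0 ≤ 64 * (r : ℝ) ^ 2 * q := by positivity
    linarith
  -- `C₁` bounds t/w²; `a₁` serves the condition relating t and k; `a₂`, `a₃`, `a₄` serve the three
  -- exponentials; `a₅` absorbs the number of tests into k^(r+1); the final 4 yields 3/k < ε.
  set a₁ : ℝ := 8 * r ^ 2 * (C₁ + 2) with ha₁
  set a₂ : ℝ := 128 * r * 2 ^ r with ha₂
  set a₃ : ℝ := 128 * r ^ 2 * 2 ^ r * (q + 1) with ha₃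
  set a₄ : ℝ := 128 * r ^ 2 * (C₁ * (r + 1) + 1) with ha₄
  set a₅ : ℝ := 2 * q ^ r * r with ha₅
  have p₁ : 0 ≤ a₁ := by positivity
  have p₂ : 0 ≤ a₂ := by positivity
  have p₃ : 0 ≤ a₃ := by positivity
  have p₄ : 0 ≤ a₄ := by positivity
  have p₅ : 0 ≤ a₅ := by positivity
  refine ⟨a₁ + a₂ + a₃ + a₄ + a₅ + 4, by linarith, ?_⟩
  intro ε hε hε1 k hk hklog
  set C := a₁ + a₂ + a₃ + a₄ + a₅ + 4 with hC
  set w := ε⁻¹ with hw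
  have hεw : ε = w⁻¹ := by rw [hw, inv_inv]
  have hw1 : 1 ≤ w := (one_le_inv₀ hε).2 (by linarith)
  have hw0 : 0 < w := by linarith
  have hw14 : w ≤ w ^ 4 := le_self_pow₀ hw1 (by norm_num)
  have hw24 : w ^ 2 ≤ w ^ 4 := pow_le_pow_right₀ hw1 (by norm_num)
  have hw34 : w ^ 3 ≤ w ^ 4 := pow_le_pow_right₀ hw1 (by norm_num)
  have hw2 : 1 ≤ w ^ 2 := one_le_pow₀ hw1
  have hw4 : 1 ≤ w ^ 4 := one_le_pow₀ hw1
  have hle : ∀ {a y : ℝ}, 0 ≤ a → a ≤ C → y ≤ w ^ 4 → a * y ≤ k := fun {a y} h0 ha hy =>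
    (mul_le_mul_of_nonneg_left hy h0).trans ((mul_le_mul_of_nonneg_right ha (by positivity)).trans
      hk)
  have hk4 : 4 * w ≤ k := hle (by norm_num) (by linarith) hw14
  have hk0 : (0 : ℝ) < k := by linarith
  have hk1 : (1 : ℝ) ≤ k := by linarith
  have hlk : 0 ≤ Real.log k := Real.log_nonneg hk1
  have hlle : ∀ {a y : ℝ}, 0 ≤ a → a ≤ C → y ≤ w ^ 4 → a * y * Real.log k ≤ k :=
    fun {a y} h0 ha hy => (mul_le_mul_of_nonneg_right ((mul_le_mul_of_nonneg_left hy h0).trans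
      (mul_le_mul_of_nonneg_right ha (by positivity))) hlk).trans hklog
  have hlq : 0 ≤ Real.log q := Real.log_nonneg hq'
  have hlq' : Real.log q ≤ q := (Real.log_le_sub_one_of_pos (by linarith)).trans (by linarith)
  have hlk' : Real.log k ≤ k := (Real.log_le_sub_one_of_pos hk0).trans (by linarith)
  have hkinv : Real.exp (-Real.log k) = 1 / k := by
    rw [Real.exp_neg, Real.exp_log hk0, one_div]
  -- Floor plus one rather than a ceiling: the inequality on t is strict, also when q = 1 and the
  -- logarithm vanishes.
  refine ⟨by exact_mod_cast hk0, ⌊64 * r ^ 2 * Real.log q * w ^ 2⌋₊ + 1, ?_⟩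
  set t := ⌊64 * r ^ 2 * Real.log q * w ^ 2⌋₊ + 1 with ht
  have htle : (t : ℝ) ≤ C₁ * w ^ 2 := by
    have h1 := Nat.floor_le (show 0 ≤ 64 * r ^ 2 * Real.log q * w ^ 2 by positivity)
    have h2 : 64 * (r : ℝ) ^ 2 * Real.log q * w ^ 2 ≤ 64 * r ^ 2 * q * w ^ 2 := by gcongr
    rw [ht, hC₁]
    push_cast
    linarith
  refine ⟨?_, ?_, ?_⟩
  · have h1 : 64 * r ^ 2 * Real.log q * w ^ 2 < t := by
      rw [ht]
      exact_mod_cast Nat.lt_floor_add_one _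
    have h2 : 4 * Real.log q = (64 * r ^ 2 * Real.log q * w ^ 2) * (ε / 4 / r) ^ 2 := by
      rw [hεw]
      field_simp
      ring
    rw [h2]
    exact mul_lt_mul_of_pos_right h1 (by positivity)
  · have h1 : a₁ * w ^ 3 ≤ k := hle p₁ (by linarith) hw34
    have h2 : 8 * (r : ℝ) ^ 2 * (t + 2) ≤ a₁ * w ^ 2 := by
      have : (t : ℝ) + 2 ≤ (C₁ + 2) * w ^ 2 := by linarith
      calc 8 * (r : ℝ) ^ 2 * (t + 2) ≤ 8 * r ^ 2 * ((C₁ + 2) * w ^ 2) := by gcongr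
        _ = _ := by rw [ha₁]; ring
    rw [hεw, inv_mul_eq_div, le_div_iff₀ hw0]
    calc _ ≤ a₁ * w ^ 2 * w := mul_le_mul_of_nonneg_right h2 hw0.le
      _ = a₁ * w ^ 3 := by ring
      _ ≤ k := h1
  · have e1 : Real.exp (-((ε / 4) ^ 2 / (8 * (r / k) * 2 ^ r))) ≤ 1 / k := by
      rw [← hkinv]
      refine Real.exp_le_exp.2 (neg_le_neg ?_)
      have h1 : a₂ * w ^ 2 * Real.log k ≤ k := hlle p₂ (by linarith) hw24
      have h2 : (ε / 4) ^ 2 / (8 * (r / k) * 2 ^ r) = k / (a₂ * w ^ 2) := by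
        rw [hεw, ha₂]
        field_simp
        norm_num
      rw [h2, le_div_iff₀ (by positivity)]
      linarith
    have e2 : (q : ℝ) ^ k * Real.exp (-((ε / 4) ^ 2 / (8 * (r ^ 2 / k ^ 2) * 2 ^ r))) ≤ 1 / k := by
      have hqk : (q : ℝ) ^ k = Real.exp (k * Real.log q) := by
        rw [mul_comm, Real.exp_mul, Real.exp_log (by linarith), Real.rpow_natCast]
      rw [hqk, ← Real.exp_add, ← hkinv]
      refine Real.exp_le_exp.2 ?_
      -- In the factor q + 1 of `a₃`, q ≥ log q pays for the q^k maps and the additional 1 leaves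
      -- exp(-k) ≤ 1/k.
      have h1 : a₃ * w ^ 2 ≤ k := hle p₃ (by linarith) hw24
      have h2 : (ε / 4) ^ 2 / (8 * ((r : ℝ) ^ 2 / k ^ 2) * 2 ^ r) =
          k ^ 2 / (128 * r ^ 2 * 2 ^ r * w ^ 2) := by
        rw [hεw]
        field_simp
        norm_num
      have h3 : k * ((q : ℝ) + 1) ≤ k ^ 2 / (128 * r ^ 2 * 2 ^ r * w ^ 2) := by
        rw [le_div_iff₀ (by positivity)]
        calc (k : ℝ) * ((q : ℝ) + 1) * (128 * r ^ 2 * 2 ^ r * w ^ 2) = k * (a₃ * w ^ 2) := by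
              rw [ha₃]; ring
          _ ≤ (k : ℝ) * k := mul_le_mul_of_nonneg_left h1 hk0.le
          _ = _ := by ring
      have h4 : k * Real.log q ≤ k * q := mul_le_mul_of_nonneg_left hlq' hk0.le
      rw [h2]
      linarith
    have e3 : ((q : ℝ) ^ r * (r * k ^ r) + 1) ^ t *
        Real.exp (-((ε / 4) ^ 2 / (8 * (r / k) * r))) ≤ 1 / k := by
      have hkr : (1 : ℝ) ≤ (k : ℝ) ^ r := one_le_pow₀ hk1
      have h0 : a₅ * 1 ≤ k := hle p₅ (by linarith) hw4
      have hbase : (q : ℝ) ^ r * (r * k ^ r) + 1 ≤ k ^ (r + 1) := by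
        have h1 : (1 : ℝ) ≤ (q : ℝ) ^ r * (r * k ^ r) :=
          one_le_mul_of_one_le_of_one_le hqr (one_le_mul_of_one_le_of_one_le hr' hkr)
        calc (q : ℝ) ^ r * (r * k ^ r) + 1 ≤ a₅ * 1 * k ^ r := by
              rw [ha₅]
              linarith
          _ ≤ k * k ^ r := mul_le_mul_of_nonneg_right h0 (by positivity)
          _ = _ := by ring
      have hpow : ((q : ℝ) ^ r * (r * k ^ r) + 1) ^ t ≤
          Real.exp (t * (r + 1) * Real.log k) := by
        refine (pow_le_pow_left₀ (by positivity) hbase t).trans (le_of_eq ?_)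
        rw [← pow_mul, mul_comm (t * ((r : ℝ) + 1)), Real.exp_mul, Real.exp_log hk0,
          ← Real.rpow_natCast]
        congr 1
        push_cast
        ring
      refine (mul_le_mul_of_nonneg_right hpow (Real.exp_pos _).le).trans ?_
      rw [← Real.exp_add, ← hkinv]
      refine Real.exp_le_exp.2 ?_
      -- The only place where w⁴ log k is needed in full: about w² tests cost w² log k, against an
      -- exponent of order k/w².
      have h1 : a₄ * w ^ 4 * Real.log k ≤ k := hlle p₄ (by linarith) le_rfl
      have h2 : (ε / 4) ^ 2 / (8 * ((r : ℝ) / k) * r) = k / (128 * r ^ 2 * w ^ 2) := by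
        rw [hεw]
        field_simp
        norm_num
      have h3 : ((C₁ * (r + 1) + 1) * w ^ 2) * Real.log k ≤ k / (128 * r ^ 2 * w ^ 2) := by
        rw [le_div_iff₀ (by positivity)]
        calc _ = a₄ * w ^ 4 * Real.log k := by rw [ha₄]; ring
          _ ≤ k := h1
      have h4 : (t : ℝ) * (r + 1) + 1 ≤ (C₁ * (r + 1) + 1) * w ^ 2 := by
        have := mul_le_mul_of_nonneg_right htle (by positivity : (0 : ℝ) ≤ r + 1)
        linarith
      have h5 := mul_le_mul_of_nonneg_right h4 hlk
      rw [h2]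
      linarith
    have h3k : 1 / (k : ℝ) + 1 / k + 1 / k < ε := by
      rw [← add_div, ← add_div, div_lt_iff₀ hk0, hεw, inv_mul_eq_div, lt_div_iff₀ hw0]
      linarith
    linarith

end Numerics


/-! ### Rescaling, and reduction of layered energies to one family. -/

section Assembly

variable {k q r : ℕ}

theorem supEnergy_const_mul {B : ℝ} (hB : 0 ≤ B) (F : (Fin r → Fin q) → Cube r r → ℝ) :
    supEnergy (fun z x => B * F z x) = B * supEnergy F := by
  have h : ∀ φ : Fin q → unitInterval → ℝ,
      ∫ x, mix (fun z x => B * F z x) φ x = B * ∫ x, mix F φ x := by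
    intro φ
    rw [← integral_const_mul]
    simp only [mix, Finset.mul_sum, mul_assoc]
  unfold supEnergy
  rw [← smul_eq_mul, ← Real.sSup_smul_of_nonneg hB]
  congr 1
  ext v
  simp only [h, Set.mem_ofPred_eq, Set.mem_smul_set, smul_eq_mul]
  constructor
  · rintro ⟨φ, hφ, rfl⟩
    exact ⟨_, ⟨φ, hφ, rfl⟩, rfl⟩
  · rintro ⟨_, ⟨φ, hφ, rfl⟩, rfl⟩
    exact ⟨φ, hφ, rfl⟩

theorem arrayEnergy_const_mul {B : ℝ} (hB : 0 ≤ B)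
    (G : (Fin r → Fin q) → (Fin r → Fin k) → ℝ) :
    arrayEnergy (fun z n => B * G z n) = B * arrayEnergy G := by
  unfold arrayEnergy
  rw [Real.mul_iSup_of_nonneg hB]
  simp only [← Finset.mul_sum, mul_left_comm]

/-- The sampling theorem for a single family of bounded functions. -/
theorem exists_sampleSize_supEnergy (r q : ℕ) (hr : 1 ≤ r) (hq : 1 ≤ q) :
    ∃ k₀ : ℝ → ℕ,
      ((fun ε : ℝ => (k₀ ε : ℝ)) =O[𝓝[>] 0] fun ε : ℝ => ε⁻¹ ^ 4 * Real.log ε⁻¹) ∧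
      ∀ ε : ℝ, 0 < ε → ∀ k : ℕ, k₀ ε ≤ k → ∀ (F : (Fin r → Fin q) → Cube r r → ℝ) (B : ℝ),
        (∀ z, Measurable (F z)) → (∀ z x, |F z x| ≤ B) →
        volume {U : Cube k r | ∃ G : (Fin r → Fin q) → (Fin r → Fin k) → ℝ,
          (∀ z n, |G z n| ≤ B) ∧
          (∀ z n, Function.Injective n → G z n = F z fun S => U (imageSubset n S)) ∧
          ε * B < |supEnergy F - arrayEnergy G|} < ENNReal.ofReal ε := by
  have : NeZero q := ⟨by omega⟩
  obtain ⟨C, hC1, hC⟩ := exists_constant_error_terms_lt r q hr hq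
  refine ⟨fun ε => sampleSize C (min ε (1 / 2)), sampleSize_isBigO hC1, ?_⟩
  intro ε hε k hk F B hF hFB
  have hB : 0 ≤ B := (abs_nonneg _).trans (hFB 0 0)
  -- The tail bound needs small ε; for larger ε the statement at 1/2 is stronger.
  set ε' := min ε (1 / 2) with hε'
  have hε'0 : 0 < ε' := lt_min hε (by norm_num)
  have hε'1 : ε' ≤ 1 / 2 := min_le_right _ _
  obtain ⟨h1, h2⟩ := sampleSize_spec hC1 hε'0 hε'1 hk
  obtain ⟨hk0, t, ht, htk, hlt⟩ := hC ε' hε'0 hε'1 k h1 h2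
  have hdiv : ∀ {y : ℝ}, |y| ≤ B → B * (y / B) = y ∧ |y / B| ≤ 1 := by
    intro y hy
    refine ⟨?_, ?_⟩
    -- For B = 0 the quotient is 0 by convention, but then y = 0 as well.
    · rcases hB.eq_or_lt with h | h
      · rw [← h] at hy ⊢
        rw [abs_nonpos_iff.1 hy]
        simp
      · field_simp
    · rw [abs_div, abs_of_nonneg hB]
      exact div_le_one_of_le₀ hy hB
  have hmain := measure_lt_abs_supEnergy_sub_arrayEnergy_le hk0 hr
    (F := fun z x => F z x / B) (fun z => (hF z).div_const B) (fun z x => (hdiv (hFB z x)).2)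
    hε'0 (by linarith) ht htk
  calc _ ≤ volume {U : Cube k r | ∃ G : (Fin r → Fin q) → (Fin r → Fin k) → ℝ,
        (∀ z n, |G z n| ≤ 1) ∧
        (∀ z n, Function.Injective n → G z n = F z (fun S => U (imageSubset n S)) / B) ∧
        ε' < |supEnergy (fun z x => F z x / B) - arrayEnergy G|} := by
        refine measure_mono ?_
        rintro U ⟨G, hG1, hGF, hGlt⟩
        refine ⟨fun z n => G z n / B, fun z n => (hdiv (hG1 z n)).2,
          fun z n hn => congrArg (· / B) (hGF z n hn), ?_⟩
        have e1 := supEnergy_const_mul hB fun z x => F z x / B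
        have e2 := arrayEnergy_const_mul hB fun z n => G z n / B
        simp only [(hdiv (hFB _ _)).1] at e1
        simp only [(hdiv (hG1 _ _)).1] at e2
        rw [e1, e2, ← mul_sub, abs_mul, abs_of_nonneg hB, mul_comm] at hGlt
        exact (min_le_left _ _).trans_lt (lt_of_mul_lt_mul_left hGlt hB)
    _ < ENNReal.ofReal ε' := by
        rw [← ENNReal.ofReal_toReal (measure_ne_top _ _)]
        exact (ENNReal.ofReal_lt_ofReal_iff hε'0).2 (hmain.trans_lt hlt)
    _ ≤ ENNReal.ofReal ε := ENNReal.ofReal_le_ofReal (min_le_left _ _)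

/-- All layers share the partition, so they merge under the integral. The number of layers then only
enters through the sup bound, and the sample size does not depend on it. -/
theorem energy_eq_supEnergy {E : Type u} {K : Type v} [Fintype E] (W : E → Cube r r → K)
    (J : E → (Fin r → Fin q) → K → ℝ) (hm : ∀ e z, Measurable fun x => J e z (W e x)) {C : ℝ}
    (hC : ∀ e z x, |J e z (W e x)| ≤ C) :
    energy W J = supEnergy fun z x => ∑ e, J e z (W e x) := by
  have h : ∀ φ : Fin q → unitInterval → ℝ, IsFractionalPartition φ →
      ∑ e, energyAt φ (W e) (J e) = ∫ x, mix (fun z x => ∑ e, J e z (W e x)) φ x := by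
    intro φ hφ
    have hint : ∀ e z, Integrable fun x : Cube r r =>
        J e z (W e x) * ∏ j, φ (z j) (x (single j)) := by
      intro e z
      refine integrable_of_measurable_of_abs_le (C := C) ((hm e z).mul
        (Finset.measurable_fun_prod _ fun j _ => (hφ.1 (z j)).comp (measurable_pi_apply _))) ?_
      intro x
      have h0 : 0 ≤ ∏ j, φ (z j) (x (single j)) := Finset.prod_nonneg fun j _ => (hφ.2.1 _ _).1
      have h1 : ∏ j, φ (z j) (x (single j)) ≤ 1 :=
        Finset.prod_le_one (fun j _ => (hφ.2.1 _ _).1) fun j _ => (hφ.2.1 _ _).2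
      rw [abs_mul, abs_of_nonneg h0]
      exact (mul_le_of_le_one_right (abs_nonneg _) h1).trans (hC e z x)
    simp only [energyAt, mix, Finset.sum_mul]
    rw [integral_finsetSum _ fun z _ => integrable_finsetSum _ fun e _ => hint e z,
      Finset.sum_comm]
    exact Finset.sum_congr rfl fun z _ => (integral_finsetSum _ fun e _ => hint e z).symm
  unfold energy supEnergy
  congr 1
  ext v
  constructor
  · rintro ⟨φ, hφ, rfl⟩
    exact ⟨φ, hφ, h φ hφ⟩
  · rintro ⟨φ, hφ, rfl⟩
    exact ⟨φ, hφ, (h φ hφ).symm⟩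

theorem intEnergy_eq_arrayEnergy {E : Type u} {K : Type v} [Fintype E]
    (G : E → (Fin r → Fin k) → K) (J : E → (Fin r → Fin q) → K → ℝ) :
    intEnergy G J = arrayEnergy fun z n => ∑ e, J e z (G e n) := by
  unfold intEnergy arrayEnergy
  congr 1
  funext σ
  have h : ∀ e, graphEnergyAt (fun n m => if σ n = m then 1 else 0) (G e) (J e) =
      ((k : ℝ) ^ r)⁻¹ * ∑ n, J e (σ ∘ n) (G e n) := by
    intro e
    rw [graphEnergyAt, one_div, Finset.sum_comm]
    congr 1
    refine Finset.sum_congr rfl fun n _ => ?_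
    rw [Finset.sum_eq_single (σ ∘ n)]
    · simp
    · intro z _ hz
      obtain ⟨j, hj⟩ := Function.ne_iff.1 hz
      rw [Finset.prod_eq_zero (Finset.mem_univ j), mul_zero]
      exact if_neg (Ne.symm hj)
    · simp
  simp only [h]
  rw [← Finset.mul_sum, Finset.sum_comm]

theorem energy_congr_ae {E : Type u} {K : Type v} [Fintype E] {W W' : E → Cube r r → K}
    (h : ∀ e, W e =ᵐ[volume] W' e) (J : E → (Fin r → Fin q) → K → ℝ) :
    energy W J = energy W' J := by
  have h1 : ∀ φ e, energyAt φ (W e) (J e) = energyAt φ (W' e) (J e) := by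
    intro φ e
    refine Finset.sum_congr rfl fun z _ => integral_congr_ae ?_
    filter_upwards [h e] with x hx
    rw [hx]
  unfold energy
  simp only [h1]

theorem sampledGraph_of_injective {K : Type*} (W : Cube r r → K) (diag : (Fin r → Fin k) → K)
    (U : Cube k r) {n : Fin r → Fin k} (hn : Function.Injective n) :
    sampledGraph W diag U n = W fun S => U (imageSubset n S) := if_pos hn

theorem sampledGraph_of_not_injective {K : Type*} (W : Cube r r → K)
    (diag : (Fin r → Fin k) → K) (U : Cube k r) {n : Fin r → Fin k}
    (hn : ¬ Function.Injective n) : sampledGraph W diag U n = diag n := if_neg hn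

theorem abs_sum_le_card_mul {E : Type u} [Fintype E] {f : E → ℝ} {C : ℝ} (h : ∀ e, |f e| ≤ C) :
    |∑ e, f e| ≤ Fintype.card E * C := by
  refine (Finset.abs_sum_le_sum_abs _ _).trans ((Finset.sum_le_sum fun e _ => h e).trans ?_)
  simp

end Assembly

end GSE

theorem theorem4p2 (r q : ℕ) (hr : 1 ≤ r) (hq : 1 ≤ q) :
    ∃ k₀ : ℝ → ℕ,
      ((fun ε : ℝ => (k₀ ε : ℝ)) =O[𝓝[>] 0] fun ε : ℝ => ε⁻¹ ^ 4 * Real.log ε⁻¹) ∧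
      ∀ ε : ℝ, 0 < ε → ∀ k : ℕ, k₀ ε ≤ k → ∀ (E : Type u) [Fintype E],
        -- a general compact colour space
        (∀ (K : Type v) [TopologicalSpace K] [CompactSpace K] [MeasurableSpace K] [BorelSpace K]
            (J : E → (Fin r → Fin q) → C(K, ℝ))
            (W : E → GSE.Cube r r → K), (∀ e, Measurable (W e)) →
            ∀ diag : E → GSE.Cube k r → (Fin r → Fin k) → K,
              volume {U : GSE.Cube k r | ε * Fintype.card E * ‖J‖ <
                |GSE.energy W (fun e z a => J e z a) -
                  GSE.intEnergy (fun e => GSE.sampledGraph (W e) (diag e U) U)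
                    (fun e z a => J e z a)|} < ENNReal.ofReal ε) ∧
        -- real colours and real interaction arrays, which act by multiplication
        (∀ (J : E → (Fin r → Fin q) → ℝ)
            (W : E → GSE.Cube r r → ℝ), (∀ e, Measurable (W e)) →
            ∀ M : ℝ, (∀ e, ∀ᵐ x, |W e x| ≤ M) →
            ∀ diag : E → GSE.Cube k r → (Fin r → Fin k) → ℝ, (∀ e U n, |diag e U n| ≤ M) →
              volume {U : GSE.Cube k r | ε * Fintype.card E * ‖J‖ * M <
                |GSE.energy W (fun e z a => J e z * a) -
                  GSE.intEnergy (fun e => GSE.sampledGraph (W e) (diag e U) U)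
                    (fun e z a => J e z * a)|} < ENNReal.ofReal ε) := by
  obtain ⟨k₀, hk₀, hmain⟩ := GSE.exists_sampleSize_supEnergy r q hr hq
  refine ⟨k₀, hk₀, fun ε hε k hk E _ => ⟨?_, ?_⟩⟩
  · intro K _ _ _ _ J W hW diag
    have hJ : ∀ e z a, |J e z a| ≤ ‖J‖ := fun e z a =>
      ((J e z).norm_coe_le_norm a).trans ((norm_le_pi_norm (J e) z).trans (norm_le_pi_norm J e))
    have hm : ∀ e z, Measurable fun x => J e z (W e x) := fun e z =>
      (J e z).continuous.measurable.comp (hW e)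
    refine lt_of_le_of_lt (measure_mono ?_) (hmain ε hε k hk (fun z x => ∑ e, J e z (W e x))
      (Fintype.card E * ‖J‖) (fun z => Finset.measurable_fun_sum _ fun e _ => hm e z)
      fun z x => GSE.abs_sum_le_card_mul fun e => hJ e z _)
    intro U hU
    rw [Set.mem_ofPred_eq, GSE.energy_eq_supEnergy W _ hm fun e z x => hJ e z _,
      GSE.intEnergy_eq_arrayEnergy, mul_assoc] at hU
    refine ⟨_, fun z n => GSE.abs_sum_le_card_mul fun e => hJ e z _, fun z n hn => ?_, hU⟩
    simp only [GSE.sampledGraph_of_injective _ _ _ hn]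
  · intro J W hW M hM diag hdiag
    have hJ : ∀ e z, |J e z| ≤ ‖J‖ := fun e z =>
      (norm_le_pi_norm (J e) z).trans (norm_le_pi_norm J e)
    -- For empty E nothing forces M ≥ 0, hence the dependence on a layer.
    have hM0 : ∀ e : E, 0 ≤ M := fun e => by
      obtain ⟨x, hx⟩ := (hM e).exists
      exact (abs_nonneg _).trans hx
    -- Clipping turns the almost everywhere bound into a pointwise one without changing the energy.
    set W' : E → GSE.Cube r r → ℝ := fun e x => max (-M) (min M (W e x)) with hW'
    have hW'M : ∀ e x, |W' e x| ≤ M := fun e x =>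
      abs_le.2 ⟨le_max_left _ _, max_le (by linarith [hM0 e]) (min_le_left _ _)⟩
    have hclip : ∀ e x, |W e x| ≤ M → W' e x = W e x := fun e x hx => by
      rw [hW']
      simp only
      rw [min_eq_right (abs_le.1 hx).2, max_eq_right (abs_le.1 hx).1]
    have hbound : ∀ e z (a : ℝ), |a| ≤ M → |J e z * a| ≤ ‖J‖ * M := fun e z a ha => by
      rw [abs_mul]
      exact mul_le_mul (hJ e z) ha (abs_nonneg _) (norm_nonneg _)
    have hm : ∀ e z, Measurable fun x => J e z * W' e x := fun e z =>
      (measurable_const.max (measurable_const.min (hW e))).const_mul _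
    have hae : ∀ e, W e =ᵐ[volume] W' e := fun e => by
      filter_upwards [hM e] with x hx
      exact (hclip e x hx).symm
    refine lt_of_le_of_lt (measure_mono_ae ?_) (hmain ε hε k hk (fun z x => ∑ e, J e z * W' e x)
      (Fintype.card E * (‖J‖ * M)) (fun z => Finset.measurable_fun_sum _ fun e _ => hm e z)
      fun z x => GSE.abs_sum_le_card_mul fun e => hbound e z _ (hW'M e x))
    -- An injective edge samples a uniform point of the cube, so null sets of the cube are almost
    -- surely avoided by all the finitely many edges and layers.
    have hsample : ∀ᵐ U : GSE.Cube k r, ∀ e (n : Fin r → Fin k), Function.Injective n →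
        |W e fun S => U (GSE.imageSubset n S)| ≤ M := by
      rw [ae_all_iff]
      intro e
      rw [ae_all_iff]
      intro n
      by_cases hn : Function.Injective n
      · filter_upwards [(GSE.measurePreserving_comp_injective (Ω := unitInterval)
          (GSE.imageSubset_injective hn)).quasiMeasurePreserving.ae (hM e)] with U hU _
        exact hU
      · exact ae_of_all _ fun U h => absurd h hn
    filter_upwards [hsample] with U hUM hU
    have hU' : ε * Fintype.card E * ‖J‖ * M < |GSE.energy W (fun e z a => J e z * a) -
        GSE.intEnergy (fun e => GSE.sampledGraph (W e) (diag e U) U) (fun e z a => J e z * a)| :=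
      hU
    rw [GSE.energy_congr_ae hae, GSE.energy_eq_supEnergy W' _ hm fun e z x =>
      hbound e z _ (hW'M e x), GSE.intEnergy_eq_arrayEnergy, mul_assoc, mul_assoc] at hU'
    refine ⟨_, fun z n => GSE.abs_sum_le_card_mul fun e => hbound e z _ ?_, fun z n hn => ?_, hU'⟩
    · by_cases hn : Function.Injective n
      · rw [GSE.sampledGraph_of_injective _ _ _ hn]
        exact hUM e n hn
      · rw [GSE.sampledGraph_of_not_injective _ _ _ hn]
        exact hdiag e U n
    · refine Finset.sum_congr rfl fun e _ => ?_
      rw [GSE.sampledGraph_of_injective _ _ _ hn, hclip e _ (hUM e n hn)]
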